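/- Let $\mathcal A$ be a hereditary abelian category, i.e. an abelian category with $\mathrm{Ext}^i_{\mathcal A}(X,Y)=0$ for all objects $X,Y$ and all $i\ge 2$. Write $D^b\mathcal A$ for its bounded derived category and $H_k=H^{-k}\colon D^b\mathcal A\to\mathcal A$ for the homology functors. All subcategories are full, closed under isomorphisms and nonempty. A subcategory of $\mathcal A$ is *narrow* if it is closed under cokernels and extensions, *wide* if it is closed under kernels, cokernels and extensions, and *coreflective* if its inclusion into $\mathcal A$ has a right adjoint. For a subcategory $\mathcal N$ of $\mathcal A$, $\mathrm{wide}\,\mathcal N$ is the intersection of all wide subcategories containing $\mathcal N$. A *narrow sequence* in $\mathcal A$ is a sequence $(\mathcal N(k))_{k\in\mathbb Z}$ of narrow subcategories such that, for all $k\in\mathbb Z$, (1) $\mathcal N(k)\subseteq\mathcal N(k+1)$, and (2) if $A\to B\to C\to D\to E$ is exact (at $B$, $C$ and $D$) with $A\in\mathcal N(k+1)$, $B,D\in\mathcal N(k)$ and $E\in\mathcal N(k-1)$, then $C\in\mathcal N(k)$. It is *coreflective* if every $\mathcal N(k)$ is coreflective in $\mathcal A$. A t-structure $(D^{\le 0},D^{\ge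 0})$ is identified with its aisle $\mathcal U=D^{\le 0}$, which determines it: $D^{\ge 0}=\{X \mid \mathrm{Hom}(U[1],X)=0 \text{ for all } U\in\mathcal U\}$. For a narrow sequence put $$\theta\big((\mathcal N(k))_k\big)=\{X\in D^b\mathcal A \mid H_k(X)\in\mathcal N(k)\text{ for all }k\in\mathbb Z\},$$ and for a subcategory $\mathcal U$ of $D^b\mathcal A$ put $\mu(\mathcal U)=(H_k\,\mathcal U)_{k\in\mathbb Z}$, where $H_k\,\mathcal U$ is the essential image of $\mathcal U$ under $H_k$. Then: 1. If $(\mathcal N(k))_k$ is a coreflective narrow sequence in $\mathcal A$ such that for every $k\in\mathbb Z$ the functor $D^b(\mathrm{wide}\,\mathcal N(k))\to D^b\mathcal A$ induced by the (exact) inclusion has a right adjoint, then $\theta((\mathcal N(k))_k)$ is the aisle $D^{\le 0}$ of a t-structure on $D^b\mathcal A$, and the resulting map $$\left\{\begin{array}{l}\text{coreflective narrow sequences }(\mathcal N(k))_k\text{ in }\mathcal A\text{ such that each}\\ D^b(\mathrm{wide}\,\mathcal N(k))\to D^b\mathcal A\text{ has a right adjoint}\end{array}\right\}\longrightarrow\{\text{t-structures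 on }D^b\mathcal A\}$$ is injective. 2. If $(D^{\le 0},D^{\ge 0})$ is a t-structure on $D^b\mathcal A$, then $\mu(D^{\le 0})$ is a coreflective narrow sequence in $\mathcal A$, and the resulting map $$\{\text{t-structures on }D^b\mathcal A\}\longrightarrow\{\text{coreflective narrow sequences in }\mathcal A\}$$ is injective. -/

import Mathlib

open CategoryTheory CategoryTheory.Limits CategoryTheory.Triangulated

universe w w' v v' u u'

noncomputable section

namespace NarrowSequences

section Abelian

variable {A : Type u} [Category.{v} A] [Abelian A]

/-- An abelian category is hereditary if its global dimension is at most one, i.e. if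
`Ext^i(X, Y) = 0` for all objects `X`, `Y` and all `i ≥ 2`. -/
def IsHereditary (A : Type u) [Category.{v} A] [Abelian A] : Prop :=
  ∀ X : A, HasProjectiveDimensionLE X 1

/-- A narrow subcategory: a full (replete, nonempty) subcategory closed under
cokernels and extensions. -/
class IsNarrow (P : ObjectProperty A) : Prop extends
  P.ContainsZero, P.IsClosedUnderCokernels, P.IsClosedUnderExtensions

/-- A wide subcategory: a full (replete, nonempty) subcategory closed under kernels,
cokernels and extensions. -/
class IsWide (P : ObjectProperty A) : Prop extends
  P.ContainsZero, P.IsClosedUnderKernels, P.IsClosedUnderCokernels,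
  P.IsClosedUnderExtensions

/-- The wide closure of a full subcategory: the intersection of all wide subcategories
containing it. -/
def wideClosure (P : ObjectProperty A) : ObjectProperty A :=
  fun X => ∀ W : ObjectProperty A, IsWide W → P ≤ W → W X

/-- A full subcategory is coreflective if its inclusion functor has a right adjoint. -/
def IsCoreflective (P : ObjectProperty A) : Prop := P.ι.IsLeftAdjoint

/-- A narrow sequence: a nondecreasing sequence of narrow subcategories indexed by `ℤ` such that,
for every exact sequence `X₀ ⟶ X₁ ⟶ X₂ ⟶ X₃ ⟶ X₄` with `X₀` in `N (k + 1)`, with `X₁` and `X₃`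
in `N k` and with `X₄` in `N (k - 1)`, the object `X₂` is in `N k`. -/
structure IsNarrowSequence (N : ℤ → ObjectProperty A) : Prop where
  isNarrow (k : ℤ) : IsNarrow (N k)
  le_succ (k : ℤ) : N k ≤ N (k + 1)
  of_exact (k : ℤ) {X₀ X₁ X₂ X₃ X₄ : A}
    (f : X₀ ⟶ X₁) (g : X₁ ⟶ X₂) (h : X₂ ⟶ X₃) (i : X₃ ⟶ X₄)
    (exact : (ComposableArrows.mk₄ f g h i).Exact)
    (h₀ : N (k + 1) X₀) (h₁ : N k X₁) (h₃ : N k X₃) (h₄ : N (k - 1) X₄) : N k X₂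

/-- A coreflective narrow sequence: a narrow sequence all of whose terms are coreflective. -/
structure IsCoreflectiveNarrowSequence (N : ℤ → ObjectProperty A) : Prop extends
    IsNarrowSequence N where
  isCoreflective (k : ℤ) : IsCoreflective (N k)

theorem isClosedUnderIsomorphisms_of_isWide (W : ObjectProperty A) [IsWide W] :
    W.IsClosedUnderIsomorphisms where
  of_iso {X Y} e hX := by
    have hk : IsLimit (KernelFork.ofι (f := (0 : X ⟶ X)) e.inv (by simp)) :=
      KernelFork.IsLimit.ofι _ _ (fun g _ => g ≫ e.hom) (by simp)
        (fun g hg m hm => by simp [← hm])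
    exact W.prop_of_isLimit_kernelFork hk hX hX

instance (W : ObjectProperty A) [IsWide W] : W.IsClosedUnderFiniteProducts := by
  have := isClosedUnderIsomorphisms_of_isWide W
  have : W.IsClosedUnderBinaryProducts :=
    { limitsOfShape_le := by
        rintro X ⟨p⟩
        have e : X ≅ p.diag.obj ⟨WalkingPair.left⟩ ⊞ p.diag.obj ⟨WalkingPair.right⟩ :=
          (IsLimit.conePointsIsoOfNatIso p.isLimit (limit.isLimit (pair _ _))
            (diagramIsoPair p.diag)) ≪≫ (biprod.isoProd _ _).symm
        exact W.prop_of_iso e.symm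
          (W.prop_biprod (p.prop_diag_obj _) (p.prop_diag_obj _)) }
  exact .mk'

instance (W : ObjectProperty A) [IsWide W] : PreservesFiniteLimits W.ι := by
  have := W.preservesKernels_ι
  exact Functor.preservesFiniteLimits_of_preservesKernels W.ι

instance (W : ObjectProperty A) [IsWide W] : PreservesFiniteColimits W.ι := by
  have := W.preservesCokernels_ι
  exact Functor.preservesFiniteColimits_of_preservesCokernels W.ι

instance (P : ObjectProperty A) : IsWide (wideClosure P) where
  exists_zero := ⟨_, isZero_zero A, fun W hW _ => by
    have := isClosedUnderIsomorphisms_of_isWide W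
    exact W.prop_of_isZero (isZero_zero A)⟩
  kernels_le := by
    rintro _ ⟨f, k, hk, hf⟩ W hW hP
    exact W.prop_of_isLimit_kernelFork hk (hf.1 W hW hP) (hf.2 W hW hP)
  cokernels_le := by
    rintro _ ⟨f, k, hk, hf⟩ W hW hP
    exact W.prop_of_isColimit_cokernelCofork hk (hf.1 W hW hP) (hf.2 W hW hP)
  prop_X₂_of_shortExact hS h₁ h₃ W hW hP :=
    W.prop_X₂_of_shortExact hS (h₁ W hW hP) (h₃ W hW hP)

end Abelian

section Derived

variable {A : Type u} [Category.{v} A] [Abelian A] [HasDerivedCategory.{w} A]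
  {B : Type u'} [Category.{v'} B] [Abelian B] [HasDerivedCategory.{w'} B]

theorem bounded_mapDerivedCategory_obj (F : B ⥤ A) [F.Additive]
    [PreservesFiniteLimits F] [PreservesFiniteColimits F] (X : DerivedCategory.Bounded B) :
    (DerivedCategory.TStructure.t (C := A)).bounded (F.mapDerivedCategory.obj X.obj) := by
  obtain ⟨X, ⟨a, ⟨K, e, hK⟩⟩, ⟨b, ⟨L, e', hL⟩⟩⟩ := X
  refine ⟨⟨a, ⟨_, F.mapDerivedCategory.mapIso e ≪≫ F.mapDerivedCategoryFactors.app K, ?_⟩⟩,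
    ⟨b, ⟨_, F.mapDerivedCategory.mapIso e' ≪≫ F.mapDerivedCategoryFactors.app L, ?_⟩⟩⟩
  · infer_instance
  · infer_instance

/-- The functor `D^b B ⥤ D^b A` induced by an exact functor `B ⥤ A`. -/
def mapBounded (F : B ⥤ A) [F.Additive] [PreservesFiniteLimits F] [PreservesFiniteColimits F] :
    DerivedCategory.Bounded B ⥤ DerivedCategory.Bounded A :=
  ObjectProperty.lift _ (DerivedCategory.Bounded.ι ⋙ F.mapDerivedCategory)
    (bounded_mapDerivedCategory_obj F)

/-- For a wide subcategory `W` of `A`, the property that the functor `D^b W ⥤ D^b A`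
induced by the inclusion has a right adjoint. -/
def HasDerivedRightAdjoint (A : Type u) [Category.{v} A] [Abelian A] [HasDerivedCategory.{w} A]
    (W : ObjectProperty A) [IsWide W] : Prop :=
  letI := HasDerivedCategory.standard W.FullSubcategory
  (mapBounded (A := A) W.ι).IsLeftAdjoint

variable (A) in
/-- The homology functor `H_k = H^{-k} : D^b A ⥤ A`. -/
def homology (k : ℤ) : DerivedCategory.Bounded A ⥤ A :=
  DerivedCategory.Bounded.ι ⋙ DerivedCategory.homologyFunctor A (-k)

/-- `θ(N)` consists of all the objects `X` in `D^b A` with `H_k X` in `N k` for all `k`. -/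
def theta (N : ℤ → ObjectProperty A) : ObjectProperty (DerivedCategory.Bounded A) :=
  fun X => ∀ k : ℤ, N k ((homology A k).obj X)

/-- `μ(U)` is the sequence of the essential images `H_k U`. -/
def mu (U : ObjectProperty (DerivedCategory.Bounded A)) : ℤ → ObjectProperty A :=
  fun k => U.map (homology A k)

/-- The right orthogonal of `U[1]`. -/
def shiftOrthogonal (U : ObjectProperty (DerivedCategory.Bounded A)) :
    ObjectProperty (DerivedCategory.Bounded A) :=
  fun X => ∀ Y, U Y → ∀ f : (shiftFunctor _ (1 : ℤ)).obj Y ⟶ X, f = 0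

end Derived

end NarrowSequences

end

/-! The engine is the splitting of truncations. Since all positive `Ext` from degree two on
vanishes, a map from an object with homology in degrees at most `n` to one with homology in degrees
at least `n + 2` is zero (`hom_eq_zero_of_add_two_le`). Hence truncation triangles split, and every
`X` in `D^b A` has its shifted homology objects as direct summands (`exists_stalk_summand`).

From t-structures to sequences: an aisle is closed under retracts, so `M` lies in `H_k` of the aisle
exactly when the stalk complex `M[k]` lies in the aisle (`mu_iff`). Cones and fibres of maps between
stalk complexes then give the closure properties of a narrow sequence, and the truncation triangle
of `Y[k]` gives the coreflection of `Y`. An aisle is recovered from its homology by dévissage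
(`theta_mu`), which gives injectivity of `μ`.

From sequences to t-structures: closure of `θ(N)` under extensions is the five-term condition
applied to the long homology sequence, and closure under shift is monotonicity. The real work is to
build approximation triangles. Splitting reduces this to an object `X` concentrated in one degree
`n`. One approximates `X` first relative to `N (n - 1)`, then the resulting cone relative to `N n`.
Each approximation coreflects into `D^b (wide (N k))`, keeps the homology in degrees at least `k`,
and replaces the `k`-th homology by its coreflection in `N k` (`exists_isTri_of_isNarrow`). The
result lies in `θ(N)` because `wide (N k) ⊆ N (k + 1)`. The remaining cone receives no nonzero map
from any `Z[j]` with `Z` in `N j`: degrees far from `n` are excluded by vanishing, `n - 1` and `n`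
by construction, and `n + 1` by an argument using the five-term condition again.

Two facts about a narrow `P` in a hereditary category support this. The wide closure of `P` consists
of the kernels of epimorphisms in `P` (`wideClosure_eq_kernelClosure`), and `P` is closed under
quotients lying in that wide closure (`prop_of_epi_of_wideClosure`). For a wide `W`, the functor
`D^b W ⥤ D^b A` is full on maps out of stalk complexes (`mapBounded_map_surjective`), so its right
adjoint yields orthogonality in `D^b A`. -/

noncomputable section

namespace NarrowSequences

/-! ### Exactness properties of distinguished triangles. -/

section Pretriangulated

open Pretriangulated

variable {C : Type u} [Category.{v} C] [Preadditive C] [HasZeroObject C] [HasShift C ℤ]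
  [∀ n : ℤ, (shiftFunctor C n).Additive] [Pretriangulated C]

/-- The morphisms `f`, `g`, `h` form a distinguished triangle. -/
def IsTri {X Y Z : C} (f : X ⟶ Y) (g : Y ⟶ Z) (h : Z ⟶ X⟦(1 : ℤ)⟧) : Prop :=
  Triangle.mk f g h ∈ distTriang C

namespace IsTri

variable {X Y Z : C} {f : X ⟶ Y} {g : Y ⟶ Z} {h : Z ⟶ X⟦(1 : ℤ)⟧}

theorem mem (hT : IsTri f g h) : Triangle.mk f g h ∈ distTriang C := hT

theorem rot (hT : IsTri f g h) : IsTri g h (-f⟦(1 : ℤ)⟧') := rot_of_distTriang _ hT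

theorem zero₁₂ (hT : IsTri f g h) : f ≫ g = 0 := comp_distTriang_mor_zero₁₂ _ hT

theorem zero₃₁ (hT : IsTri f g h) : h ≫ f⟦(1 : ℤ)⟧' = 0 := comp_distTriang_mor_zero₃₁ _ hT

theorem yoneda₂ (hT : IsTri f g h) {W : C} (φ : Y ⟶ W) (hφ : f ≫ φ = 0) :
    ∃ ψ : Z ⟶ W, φ = g ≫ ψ := Triangle.yoneda_exact₂ _ hT φ hφ

theorem yoneda₃ (hT : IsTri f g h) {W : C} (φ : Z ⟶ W) (hφ : g ≫ φ = 0) :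
    ∃ ψ : X⟦(1 : ℤ)⟧ ⟶ W, φ = h ≫ ψ := Triangle.yoneda_exact₃ _ hT φ hφ

theorem coyoneda₁ (hT : IsTri f g h) {W : C} (φ : W ⟶ X⟦(1 : ℤ)⟧) (hφ : φ ≫ f⟦(1 : ℤ)⟧' = 0) :
    ∃ ψ : W ⟶ Z, φ = ψ ≫ h := Triangle.coyoneda_exact₁ _ hT φ hφ

theorem coyoneda₂ (hT : IsTri f g h) {W : C} (φ : W ⟶ Y) (hφ : φ ≫ g = 0) :
    ∃ ψ : W ⟶ X, φ = ψ ≫ f := Triangle.coyoneda_exact₂ _ hT φ hφ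

theorem coyoneda₃ (hT : IsTri f g h) {W : C} (φ : W ⟶ Z) (hφ : φ ≫ h = 0) :
    ∃ ψ : W ⟶ Y, φ = ψ ≫ g := Triangle.coyoneda_exact₃ _ hT φ hφ

theorem yoneda₁ (hT : IsTri f g h) {W : C} (φ : X⟦(1 : ℤ)⟧ ⟶ W) (hφ : h ≫ φ = 0) :
    ∃ ψ : Y⟦(1 : ℤ)⟧ ⟶ W, φ = f⟦(1 : ℤ)⟧' ≫ ψ := by
  obtain ⟨ψ, rfl⟩ := hT.rot.yoneda₃ φ hφ
  exact ⟨-ψ, by rw [Preadditive.neg_comp, Preadditive.comp_neg]⟩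

theorem complete₃ (hT : IsTri f g h) {X' Y' Z' : C} {f' : X' ⟶ Y'} {g' : Y' ⟶ Z'}
    {h' : Z' ⟶ X'⟦(1 : ℤ)⟧} (hT' : IsTri f' g' h') (a : X ⟶ X') (b : Y ⟶ Y')
    (H : f ≫ b = a ≫ f') : ∃ c : Z ⟶ Z', g ≫ c = b ≫ g' ∧ h ≫ a⟦(1 : ℤ)⟧' = c ≫ h' :=
  complete_distinguished_triangle_morphism _ _ hT hT' a b H

theorem complete₂ (hT : IsTri f g h) {X' Y' Z' : C} {f' : X' ⟶ Y'} {g' : Y' ⟶ Z'}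
    {h' : Z' ⟶ X'⟦(1 : ℤ)⟧} (hT' : IsTri f' g' h') (a : X ⟶ X') (c : Z ⟶ Z')
    (H : h ≫ a⟦(1 : ℤ)⟧' = c ≫ h') : ∃ b : Y ⟶ Y', f ≫ b = a ≫ f' ∧ g ≫ c = b ≫ g' :=
  complete_distinguished_triangle_morphism₂ _ _ hT hT' a c H

theorem of_iso (hT : IsTri f g h) {X' Y' Z' : C} {f' : X' ⟶ Y'} {g' : Y' ⟶ Z'}
    {h' : Z' ⟶ X'⟦(1 : ℤ)⟧} (e₁ : X ≅ X') (e₂ : Y ≅ Y') (e₃ : Z ≅ Z')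
    (H₁ : f ≫ e₂.hom = e₁.hom ≫ f') (H₂ : g ≫ e₃.hom = e₂.hom ≫ g')
    (H₃ : h ≫ e₁.hom⟦(1 : ℤ)⟧' = e₃.hom ≫ h') : IsTri f' g' h' :=
  isomorphic_distinguished _ hT _ (Triangle.isoMk (Triangle.mk f g h) (Triangle.mk f' g' h')
    e₁ e₂ e₃ H₁ H₂ H₃).symm

theorem exists_of_mor₁ {X Y : C} (f : X ⟶ Y) :
    ∃ (Z : C) (g : Y ⟶ Z) (h : Z ⟶ X⟦(1 : ℤ)⟧), IsTri f g h := distinguished_cocone_triangle f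

theorem exists_of_mor₂ {Y Z : C} (g : Y ⟶ Z) :
    ∃ (X : C) (f : X ⟶ Y) (h : Z ⟶ X⟦(1 : ℤ)⟧), IsTri f g h := distinguished_cocone_triangle₁ g

theorem exists_of_mor₃ {Z X : C} (h : Z ⟶ X⟦(1 : ℤ)⟧) :
    ∃ (Y : C) (f : X ⟶ Y) (g : Y ⟶ Z), IsTri f g h := distinguished_cocone_triangle₂ h

/-- The cone of a composition is an extension of the cones. -/
theorem comp [IsTriangulated C] {X Y Z U V : C} {f : X ⟶ Y} {f' : Y ⟶ U} {f'' : U ⟶ X⟦(1 : ℤ)⟧}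
    {g : Y ⟶ Z} {g' : Z ⟶ V} {g'' : V ⟶ Y⟦(1 : ℤ)⟧} (hf : IsTri f f' f'') (hg : IsTri g g' g'') :
    ∃ (W : C) (c : Z ⟶ W) (d : W ⟶ X⟦(1 : ℤ)⟧) (a : U ⟶ W) (b : W ⟶ V) (e : V ⟶ U⟦(1 : ℤ)⟧),
      IsTri (f ≫ g) c d ∧ IsTri a b e := by
  obtain ⟨W, c, d, hfg⟩ := exists_of_mor₁ (f ≫ g)
  let o := someOctahedron rfl hf.mem hg.mem hfg.mem
  exact ⟨W, c, d, _, _, _, hfg, o.mem⟩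

/-- Dually, the fibre of a composition is an extension of the fibres. -/
theorem comp_fibre [IsTriangulated C] {X Y Z U V : C} {u : U ⟶ X} {f : X ⟶ Y}
    {u' : Y ⟶ U⟦(1 : ℤ)⟧} {v : V ⟶ Y} {g : Y ⟶ Z} {v' : Z ⟶ V⟦(1 : ℤ)⟧}
    (hf : IsTri u f u') (hg : IsTri v g v') :
    ∃ (W : C) (c : W ⟶ X) (d : Z ⟶ W⟦(1 : ℤ)⟧) (a : U ⟶ W) (b : W ⟶ V) (e : V ⟶ U⟦(1 : ℤ)⟧),
      IsTri c (f ≫ g) d ∧ IsTri a b e := by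
  obtain ⟨W, c, d, hfg⟩ := exists_of_mor₂ (f ≫ g)
  let o := someOctahedron' rfl hf.mem hg.mem hfg.mem
  exact ⟨W, c, d, _, _, _, hfg, o.mem⟩

theorem shift (hT : IsTri f g h) (n : ℤ) :
    ∃ h' : Z⟦n⟧ ⟶ X⟦n⟧⟦(1 : ℤ)⟧, IsTri (f⟦n⟧') (g⟦n⟧') h' := by
  have H : IsTri (n.negOnePow • f⟦n⟧') (n.negOnePow • g⟦n⟧')
      (((Triangle.shiftFunctor C n).obj (Triangle.mk f g h)).mor₃) :=
    Triangle.shift_distinguished _ hT n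
  -- The shifted triangle carries the sign `(-1)^n` on its morphisms; sign automorphisms of the two
  -- outer terms absorb it in the first two, and the third may be arbitrary.
  let e (W : C) : W ≅ W :=
    { hom := n.negOnePow • 𝟙 W
      inv := n.negOnePow • 𝟙 W
      hom_inv_id := by simp [smul_smul]
      inv_hom_id := by simp [smul_smul] }
  generalize ((Triangle.shiftFunctor C n).obj (Triangle.mk f g h)).mor₃ = k at H
  change Z⟦n⟧ ⟶ X⟦n⟧⟦(1 : ℤ)⟧ at k
  refine ⟨(e _).inv ≫ k ≫ (e _).hom⟦(1 : ℤ)⟧', H.of_iso (e _) (Iso.refl _) (e _) ?_ ?_ ?_⟩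
  · simp [e]
  · simp [e, smul_smul]
  · exact ((e _).hom_inv_id_assoc _).symm

/-- If the connecting morphism vanishes, the middle term is the direct sum of the outer ones. -/
theorem split (hT : IsTri f g h) (hh : h = 0) :
    ∃ (r : Y ⟶ X) (s : Z ⟶ Y), f ≫ r = 𝟙 X ∧ s ≫ g = 𝟙 Z ∧ r ≫ f + g ≫ s = 𝟙 Y ∧ s ≫ r = 0 := by
  subst hh
  obtain ⟨s, hs⟩ := hT.coyoneda₃ (𝟙 Z) (by simp)
  obtain ⟨r, hr⟩ := hT.coyoneda₂ (𝟙 Y - g ≫ s) (by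
    rw [Preadditive.sub_comp, Category.assoc, ← hs]
    simp)
  have hm : Mono f := (Triangle.mor₃_eq_zero_iff_mono₁ _ hT).1 rfl
  refine ⟨r, s, ?_, hs.symm, by rw [← hr]; abel, ?_⟩
  · rw [← cancel_mono f, Category.assoc, ← hr, Preadditive.comp_sub, ← Category.assoc, hT.zero₁₂]
    simp
  · rw [← cancel_mono f, Category.assoc, ← hr, Preadditive.comp_sub, ← Category.assoc, ← hs]
    simp

end IsTri

end Pretriangulated

/-! ### Extensions in `A` as degree-one maps in the derived category. -/

open DerivedCategory Pretriangulated

variable {A : Type u} [Category.{v} A] [Abelian A] [HasDerivedCategory.{w} A]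

/-- The vanishing of `Ext^2`. -/
def ExtTwoVanishes (A : Type u) [Category.{v} A] [Abelian A] [HasDerivedCategory.{w} A] : Prop :=
  ∀ (M N : A) (f : (singleFunctor A 0).obj M ⟶ ((singleFunctor A 0).obj N)⟦(2 : ℤ)⟧), f = 0

theorem IsHereditary.extTwoVanishes (hA : IsHereditary A) : ExtTwoVanishes A := by
  intro M N f
  have := HasExt.standard A
  have := hA M
  have := HasProjectiveDimensionLT.subsingleton M 2 2 le_rfl N
  have h := (Abelian.Ext.homEquiv (X := M) (Y := N) (n := 2)).symm.injective.eq_iff (a := f) (b := 0)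
  exact h.1 (Subsingleton.elim _ _)

/-- A positive-degree class dies after pulling back along a suitable epimorphism. -/
theorem exists_epi_comp_eq_zero {M N : A} {n : ℤ} (hn : 0 < n)
    (f : (singleFunctor A 0).obj M ⟶ ((singleFunctor A 0).obj N)⟦n⟧) :
    ∃ (E : A) (p : E ⟶ M), Epi p ∧ (singleFunctor A 0).map p ≫ f = 0 := by
  let e : ((singleFunctor A 0).obj N)⟦n⟧ ≅ (singleFunctor A (-n)).obj N :=
    ((singleFunctors A).shiftIso n (-n) 0 (by lia)).app N
  let φ : Q.obj ((CochainComplex.singleFunctor A 0).obj M) ⟶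
    Q.obj ((CochainComplex.singleFunctor A (-n)).obj N) := f ≫ e.hom
  -- A roof `M ← K → N[n]` with `K` in cohomological degrees at most zero represents the class. The
  -- epimorphism sought is `K⁰ → H⁰(K) ≅ M`: as `K¹ = 0`, all of `K⁰` consists of cycles.
  obtain ⟨K, _, π, h, g, hφ⟩ := right_fac_of_isStrictlyLE φ 0
  rw [isIso_Q_map_iff_quasiIso] at h
  have hK : IsZero (K.X 1) := K.isZero_of_isStrictlyLE 0 1 (by simp)
  let i : (CochainComplex.singleFunctor A 0).obj (K.X 0) ⟶ K :=
    HomologicalComplex.mkHomFromSingle (𝟙 _) (by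
      rintro j hj
      obtain rfl : j = 1 := by simpa using hj.symm
      exact hK.eq_of_tgt _ _)
  obtain ⟨p, hp⟩ := (CochainComplex.singleFunctor A 0).map_surjective (i ≫ π)
  refine ⟨K.X 0, p, ?_, ?_⟩
  · have hi : Epi (HomologicalComplex.homologyMap i 0) := by
      let c := K.iCyclesIso 0 1 (by simp) (hK.eq_of_tgt _ _)
      have h1 : HomologicalComplex.cyclesMap i 0 ≫ K.iCycles 0 =
          HomologicalComplex.iCycles _ 0 ≫ i.f 0 := by simp
      have : IsIso (i.f 0) := by
        dsimp [i]
        rw [HomologicalComplex.mkHomFromSingle_f, Category.comp_id]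
        exact (HomologicalComplex.singleObjXSelf (ComplexShape.up ℤ) 0 (K.X 0)).isIso_hom
      have : IsIso (K.iCycles 0) := by
        change IsIso c.hom
        infer_instance
      have : IsIso (((CochainComplex.singleFunctor A 0).obj (K.X 0)).iCycles 0) := by
        have := HomologicalComplex.singleObjCyclesSelfIso_inv_iCycles (ComplexShape.up ℤ) 0 (K.X 0)
        rw [Iso.inv_comp_eq] at this
        change IsIso (HomologicalComplex.iCycles
          ((HomologicalComplex.single A (ComplexShape.up ℤ) 0).obj (K.X 0)) 0)
        rw [this]
        infer_instance
      have : IsIso (HomologicalComplex.cyclesMap i 0) := by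
        have : IsIso (HomologicalComplex.cyclesMap i 0 ≫ K.iCycles 0) := by
          rw [h1]
          infer_instance
        exact IsIso.of_isIso_comp_right _ (K.iCycles 0)
      have h2 := HomologicalComplex.homologyπ_naturality i 0
      have : Epi (HomologicalComplex.homologyπ _ 0 ≫ HomologicalComplex.homologyMap i 0) := by
        rw [h2]
        infer_instance
      exact epi_of_epi (HomologicalComplex.homologyπ _ 0) _
    have h3 : Epi ((HomologicalComplex.homologyFunctor A (ComplexShape.up ℤ) 0).map
        ((CochainComplex.singleFunctor A 0).map p)) := by
      rw [hp, Functor.map_comp]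
      change Epi (HomologicalComplex.homologyMap i 0 ≫ HomologicalComplex.homologyMap π 0)
      infer_instance
    exact ((MorphismProperty.epimorphisms A).arrow_mk_iso_iff
      (((Functor.mapArrowFunctor _ _).mapIso
        (HomologicalComplex.homologyFunctorSingleIso A (ComplexShape.up ℤ) 0)).app
          (Arrow.mk p))).1 h3
  -- A chain map from degree `0` to degree `-n ≠ 0` between single complexes vanishes.
  · have h4 : i ≫ g = 0 := by
      apply HomologicalComplex.from_single_hom_ext
      apply (HomologicalComplex.isZero_single_obj_X _ _ _ _ (by lia)).eq_of_tgt
    rw [← cancel_mono e.hom, zero_comp, Category.assoc]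
    change Q.map ((CochainComplex.singleFunctor A 0).map p) ≫ φ = 0
    rw [hφ, hp, Q.map_comp, Category.assoc, IsIso.hom_inv_id_assoc, ← Q.map_comp, h4, Q.map_zero]

theorem exists_iso_singleFunctor_of_distTriang {M N : A} {Y : DerivedCategory A}
    {f : (singleFunctor A 0).obj M ⟶ Y} {g : Y ⟶ (singleFunctor A 0).obj N}
    {h : (singleFunctor A 0).obj N ⟶ ((singleFunctor A 0).obj M)⟦(1 : ℤ)⟧} (hT : IsTri f g h) :
    ∃ Y' : A, Nonempty (Y ≅ (singleFunctor A 0).obj Y') := by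
  have h1 : TStructure.t.IsLE Y 0 := TStructure.t.isLE₂ _ hT 0
    (inferInstanceAs (TStructure.t.IsLE ((singleFunctor A 0).obj M) 0))
    (inferInstanceAs (TStructure.t.IsLE ((singleFunctor A 0).obj N) 0))
  have h2 : TStructure.t.IsGE Y 0 := TStructure.t.isGE₂ _ hT 0
    (inferInstanceAs (TStructure.t.IsGE ((singleFunctor A 0).obj M) 0))
    (inferInstanceAs (TStructure.t.IsGE ((singleFunctor A 0).obj N) 0))
  exact exists_iso_singleFunctor_obj_of_isGE_of_isLE Y 0

theorem _root_.CategoryTheory.ShortComplex.ShortExact.isTri {S : ShortComplex A}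
    (hS : S.ShortExact) : IsTri ((singleFunctor A 0).map S.f) ((singleFunctor A 0).map S.g)
      hS.singleδ := hS.singleTriangle_distinguished

/-- A distinguished triangle on objects of the heart comes from a short exact sequence. -/
theorem shortExact_of_distTriang {X Y Z : A} (i : X ⟶ Y) (p : Y ⟶ Z)
    (δ : (singleFunctor A 0).obj Z ⟶ ((singleFunctor A 0).obj X)⟦(1 : ℤ)⟧)
    (hT : IsTri ((singleFunctor A 0).map i) ((singleFunctor A 0).map p) δ) :
    ∃ (w : i ≫ p = 0) (hS : (ShortComplex.mk i p w).ShortExact), hS.singleδ = δ := by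
  have w : i ≫ p = 0 := (singleFunctor A 0).map_injective (by
    simpa using hT.zero₁₂)
  have iso {X Y : A} (f : X ⟶ Y) := (((Functor.mapArrowFunctor _ _).mapIso
        (singleFunctorCompHomologyFunctorIso A 0)).app (Arrow.mk f))
  have hm : Mono i := by
    refine ((MorphismProperty.monomorphisms A).arrow_mk_iso_iff (iso i)).1 ?_
    change Mono ((homologyFunctor A 0).map ((singleFunctor A 0).map i))
    refine (HomologySequence.mono_homologyMap_mor₁_iff _ hT (-1) 0).2 ?_
    exact (isZero_of_isGE ((singleFunctor A 0).obj Z) 0 (-1) (by lia)).eq_of_src _ _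
  have he : Epi p := by
    refine ((MorphismProperty.epimorphisms A).arrow_mk_iso_iff (iso p)).1 ?_
    change Epi ((homologyFunctor A 0).map ((singleFunctor A 0).map p))
    refine (HomologySequence.epi_homologyMap_mor₂_iff _ hT 0 1).2 ?_
    exact (isZero_of_isLE ((singleFunctor A 0).obj X) 0 1 (by lia)).eq_of_tgt _ _
  have hex : (ShortComplex.mk i p w).Exact := by
    have := HomologySequence.exact₂ _ hT 0
    refine (ShortComplex.exact_iff_of_iso ?_).1 this
    exact (ShortComplex.mapNatIso (ShortComplex.mk i p w) (singleFunctorCompHomologyFunctorIso A 0))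
  have hS : (ShortComplex.mk i p w).ShortExact := { exact := hex }
  refine ⟨w, hS, ?_⟩
  -- Comparing the two triangles gives an endomorphism `c` of `Z` with `p ≫ c = p`; as `p` is epi,
  -- `c` is the identity and the connecting maps agree.
  obtain ⟨c, hc1, hc2⟩ := hS.isTri.complete₃ hT (𝟙 _) (𝟙 _) (by simp)
  obtain ⟨c, rfl⟩ := (singleFunctor A 0).map_surjective c
  obtain rfl : c = 𝟙 _ := by
    rw [← cancel_epi p]
    apply (singleFunctor A 0).map_injective
    simpa using hc1
  simpa using hc2

/-- The heart is closed under extensions, so the middle term of a triangle completing `δ` is again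
an object of `A`. -/
theorem exists_shortExact_singleδ_eq {X Z : A}
    (δ : (singleFunctor A 0).obj Z ⟶ ((singleFunctor A 0).obj X)⟦(1 : ℤ)⟧) :
    ∃ (Y : A) (i : X ⟶ Y) (p : Y ⟶ Z) (w : i ≫ p = 0)
      (hS : (ShortComplex.mk i p w).ShortExact), hS.singleδ = δ := by
  obtain ⟨Y, f, g, hT⟩ := IsTri.exists_of_mor₃ δ
  obtain ⟨Y', ⟨e⟩⟩ := exists_iso_singleFunctor_of_distTriang hT
  obtain ⟨i, hi⟩ := (singleFunctor A 0).map_surjective (f ≫ e.hom)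
  obtain ⟨p, hp⟩ := (singleFunctor A 0).map_surjective (e.inv ≫ g)
  refine ⟨Y', i, p, shortExact_of_distTriang i p δ
    (hT.of_iso (Iso.refl _) e (Iso.refl _) (by simp [hi]) (by simp [hp]) (by simp))⟩

/-- A morphism between short exact sequences with prescribed ends. -/
theorem exists_hom_of_singleδ {S₁ S₂ : ShortComplex A} (h₁ : S₁.ShortExact) (h₂ : S₂.ShortExact)
    (a : S₁.X₁ ⟶ S₂.X₁) (c : S₁.X₃ ⟶ S₂.X₃)
    (h : h₁.singleδ ≫ ((singleFunctor A 0).map a)⟦(1 : ℤ)⟧' =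
      (singleFunctor A 0).map c ≫ h₂.singleδ) :
    ∃ b : S₁.X₂ ⟶ S₂.X₂, S₁.f ≫ b = a ≫ S₂.f ∧ S₁.g ≫ c = b ≫ S₂.g := by
  obtain ⟨b, hb1, hb2⟩ := h₁.isTri.complete₂ h₂.isTri
    ((singleFunctor A 0).map a) ((singleFunctor A 0).map c) h
  obtain ⟨b, rfl⟩ := (singleFunctor A 0).map_surjective b
  exact ⟨b, (singleFunctor A 0).map_injective (by simpa using hb1),
    (singleFunctor A 0).map_injective (by simpa using hb2)⟩

open DerivedCategory Pretriangulated

/-! ### Lifting extensions when `Ext^2` vanishes. -/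

section Lifting

variable {A : Type u} [Category.{v} A] [Abelian A] [HasDerivedCategory.{w} A]

/-- Dimension shifting: a class killed by an epimorphism onto `M` factors through the connecting map
to the shifted kernel, leaving a class of one degree less. -/
theorem hom_shift_eq_zero (hA : ExtTwoVanishes A) {n : ℤ} (hn : 2 ≤ n) {M N : A}
    (f : (singleFunctor A 0).obj M ⟶ ((singleFunctor A 0).obj N)⟦n⟧) : f = 0 := by
  induction n, hn using Int.leInduction generalizing M with
  | base => exact hA M N f
  | succ n hn ih =>
    obtain ⟨E, p, hp, h⟩ := exists_epi_comp_eq_zero (by lia) f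
    have hS : (ShortComplex.mk (kernel.ι p) p (kernel.condition p)).ShortExact :=
      { exact := ShortComplex.exact_kernel p }
    obtain ⟨ψ, rfl⟩ := hS.isTri.yoneda₃ f h
    obtain ⟨β, hβ⟩ := (shiftFunctor _ (1 : ℤ)).map_surjective
      (ψ ≫ ((shiftFunctorAdd (DerivedCategory A) n 1).app _).hom)
    rw [ih β, Functor.map_zero] at hβ
    have : ψ = 0 := by
      rw [← cancel_mono ((shiftFunctorAdd (DerivedCategory A) n 1).app _).hom, ← hβ, zero_comp]
    rw [this, comp_zero]

theorem hom_shift_shift_eq_zero (hA : ExtTwoVanishes A) {M N : A}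
    (f : (singleFunctor A 0).obj M ⟶ ((singleFunctor A 0).obj N)⟦(1 : ℤ)⟧⟦(1 : ℤ)⟧) : f = 0 := by
  rw [← cancel_mono ((shiftFunctorAdd' (DerivedCategory A) (1 : ℤ) 1 2 (by lia)).app _).inv,
    zero_comp]
  exact hA _ _ _

/-- The obstruction to extending `δ` is a map from `S.X₃` to `N[2]`. -/
theorem exists_extend_along_mono (hA : ExtTwoVanishes A) {S : ShortComplex A} (hS : S.ShortExact)
    {N : A} (δ : (singleFunctor A 0).obj S.X₁ ⟶ ((singleFunctor A 0).obj N)⟦(1 : ℤ)⟧) :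
    ∃ γ : (singleFunctor A 0).obj S.X₂ ⟶ ((singleFunctor A 0).obj N)⟦(1 : ℤ)⟧,
      δ = (singleFunctor A 0).map S.f ≫ γ := by
  obtain ⟨ψ, hψ⟩ := hS.isTri.yoneda₁ (δ⟦(1 : ℤ)⟧') (hom_shift_shift_eq_zero hA _)
  obtain ⟨γ, rfl⟩ := (shiftFunctor _ (1 : ℤ)).map_surjective ψ
  exact ⟨γ, (shiftFunctor _ (1 : ℤ)).map_injective (by rw [hψ, Functor.map_comp])⟩

/-- Dually, the obstruction is a map from `M` to `S.X₁[2]`. -/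
theorem exists_lift_along_epi (hA : ExtTwoVanishes A) {S : ShortComplex A} (hS : S.ShortExact)
    {M : A} (δ : (singleFunctor A 0).obj M ⟶ ((singleFunctor A 0).obj S.X₃)⟦(1 : ℤ)⟧) :
    ∃ γ : (singleFunctor A 0).obj M ⟶ ((singleFunctor A 0).obj S.X₂)⟦(1 : ℤ)⟧,
      γ ≫ ((singleFunctor A 0).map S.g)⟦(1 : ℤ)⟧' = δ := by
  obtain ⟨ψ, hψ⟩ := hS.isTri.rot.rot.coyoneda₁ δ (hom_shift_shift_eq_zero hA _)
  exact ⟨-ψ, by rw [hψ, Preadditive.neg_comp, Preadditive.comp_neg]⟩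

/-- If `Ext^2` vanishes, extensions extend along monomorphisms. -/
theorem exists_extension_of_mono (hA : ExtTwoVanishes A) {S : ShortComplex A}
    (hS : S.ShortExact) {E : A} (j : S.X₃ ⟶ E) [Mono j] :
    ∃ (P : A) (i : S.X₁ ⟶ P) (p : P ⟶ E) (w : i ≫ p = 0) (b : S.X₂ ⟶ P),
      (ShortComplex.mk i p w).ShortExact ∧ S.f ≫ b = i ∧ b ≫ p = S.g ≫ j := by
  have hT : (ShortComplex.mk j (cokernel.π j) (cokernel.condition j)).ShortExact :=
    { exact := ShortComplex.exact_cokernel j }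
  obtain ⟨γ, hγ⟩ := exists_extend_along_mono hA hT hS.singleδ
  obtain ⟨P, i, p, w, hP, h⟩ := exists_shortExact_singleδ_eq γ
  obtain ⟨b, hb1, hb2⟩ := exists_hom_of_singleδ hS hP (𝟙 _) j (by simpa [h] using hγ)
  exact ⟨P, i, p, w, b, hP, by simpa using hb1, by simpa using hb2.symm⟩

/-- If `Ext^2` vanishes, extensions lift along epimorphisms. -/
theorem exists_extension_of_epi (hA : ExtTwoVanishes A) {S : ShortComplex A}
    (hS : S.ShortExact) {X : A} (q : X ⟶ S.X₁) [Epi q] :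
    ∃ (P : A) (i : X ⟶ P) (p : P ⟶ S.X₃) (w : i ≫ p = 0) (b : P ⟶ S.X₂),
      (ShortComplex.mk i p w).ShortExact ∧ i ≫ b = q ≫ S.f ∧ b ≫ S.g = p := by
  have hq : (ShortComplex.mk (kernel.ι q) q (kernel.condition q)).ShortExact :=
    { exact := ShortComplex.exact_kernel q }
  obtain ⟨γ, hγ⟩ := exists_lift_along_epi hA hq hS.singleδ
  obtain ⟨P, i, p, w, hP, h⟩ := exists_shortExact_singleδ_eq γ
  obtain ⟨b, hb1, hb2⟩ := exists_hom_of_singleδ hP hS q (𝟙 _) (by simpa [h] using hγ)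
  exact ⟨P, i, p, w, b, hP, hb1, by simpa using hb2.symm⟩

end Lifting

/-! ### The wide closure of a narrow subcategory. -/

section Abelian

variable {A : Type u} [Category.{v} A] [Abelian A]

/-- Pushing out a short exact sequence along a morphism from its first term. -/
theorem exists_pushforward {S : ShortComplex A} (hS : S.ShortExact) {Y : A} (a : S.X₁ ⟶ Y) :
    ∃ (P : A) (i : Y ⟶ P) (p : P ⟶ S.X₃) (w : i ≫ p = 0) (b : S.X₂ ⟶ P),
      (ShortComplex.mk i p w).ShortExact ∧ IsPushout S.f a b i ∧ b ≫ p = S.g := by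
  have := hS.mono_f
  have := hS.epi_g
  have sq := IsPushout.of_hasPushout S.f a
  let p : pushout S.f a ⟶ S.X₃ := pushout.desc S.g 0 (by simp)
  have hp : pushout.inl S.f a ≫ p = S.g := pushout.inl_desc _ _ _
  have w : pushout.inr S.f a ≫ p = 0 := pushout.inr_desc _ _ _
  have : Epi (pushout.inl S.f a ≫ p) := by rwa [hp]
  have hc : IsColimit (CokernelCofork.ofπ p w) :=
    CokernelCofork.IsColimit.ofπ _ _
      (fun z hz => hS.exact.desc (pushout.inl S.f a ≫ z) (by
        rw [pushout.condition_assoc, hz, comp_zero]))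
      (fun z hz => by
        apply pushout.hom_ext
        · rw [reassoc_of% hp, hS.exact.g_desc]
        · exact ((reassoc_of% w) _).trans (zero_comp.trans hz.symm))
      (fun z hz m hm => by
        rw [← cancel_epi S.g, hS.exact.g_desc, ← hm, ← hp, Category.assoc])
  exact ⟨_, _, p, w, _, { exact := ShortComplex.exact_of_g_is_cokernel _ hc
                          mono_f := by dsimp; infer_instance
                          epi_g := epi_of_epi (pushout.inl S.f a) p }, sq, hp⟩

/-- In a morphism of short exact sequences which is the identity on the right, the kernels of the
other components agree. -/
def kernelIsoOfComm {S : ShortComplex A} (hS : S.ShortExact) {Y P : A} {a : S.X₁ ⟶ Y}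
    {b : S.X₂ ⟶ P} {i : Y ⟶ P} {p : P ⟶ S.X₃} [Mono S.f] [Mono i]
    (h₁ : S.f ≫ b = a ≫ i) (h₂ : b ≫ p = S.g) :
    kernel a ≅ kernel b where
  hom := kernel.lift _ (kernel.ι a ≫ S.f) (by simp [h₁])
  inv := kernel.lift _ (hS.exact.lift (kernel.ι b) (by rw [← h₂]; simp)) (by
    rw [← cancel_mono i, Category.assoc, ← h₁, hS.exact.lift_f_assoc]
    simp)
  hom_inv_id := by
    rw [← cancel_mono (kernel.ι a), ← cancel_mono S.f]
    simp
  inv_hom_id := by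
    rw [← cancel_mono (kernel.ι b)]
    simp

/-- In a morphism of short exact sequences which is the identity on the left, the cokernels of the
other components agree. -/
def cokernelIsoOfComm {S : ShortComplex A} (hS : S.ShortExact) {Y P : A} {c : Y ⟶ S.X₃}
    {b : P ⟶ S.X₂} {i : S.X₁ ⟶ P} {p : P ⟶ Y} [Epi S.g] [Epi p]
    (h₁ : b ≫ S.g = p ≫ c) (h₂ : i ≫ b = S.f) :
    cokernel b ≅ cokernel c where
  hom := cokernel.desc _ (S.g ≫ cokernel.π c) (by rw [reassoc_of% h₁]; simp)
  inv := cokernel.desc _ (hS.exact.desc (cokernel.π b) (by rw [← h₂]; simp)) (by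
    rw [← cancel_epi p, ← reassoc_of% h₁, hS.exact.g_desc]
    simp)
  hom_inv_id := by
    rw [← cancel_epi (cokernel.π b)]
    simp
  inv_hom_id := by
    rw [← cancel_epi (cokernel.π c), ← cancel_epi S.g]
    simp

theorem isClosedUnderIsomorphisms_of_isNarrow (P : ObjectProperty A) [IsNarrow P] :
    P.IsClosedUnderIsomorphisms where
  of_iso {X Y} e hX := by
    have hk : IsColimit (CokernelCofork.ofπ (f := (0 : X ⟶ X)) e.hom (by simp)) :=
      CokernelCofork.IsColimit.ofπ _ _ (fun g _ => e.inv ≫ g) (by simp)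
        (fun g hg m hm => by simp [← hm])
    exact P.prop_of_isColimit_cokernelCofork hk hX hX

/-- The cokernels of two composable monomorphisms and of their composition form a short exact
sequence; more generally the first morphism is arbitrary. -/
theorem exists_shortExact_cokernel_comp {X Y Z : A} (f : X ⟶ Y) (g : Y ⟶ Z) [Mono g] :
    ∃ (w : cokernel.map f (f ≫ g) (𝟙 _) g (by simp) ≫
        cokernel.map (f ≫ g) g f (𝟙 _) (by simp) = 0),
      (ShortComplex.mk _ _ w).ShortExact := by
  let D := kernelCokernelCompSequence.snakeInput f g
  have hm : Mono D.L₃.f := (ShortComplex.exact_iff_mono _ (by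
    have : IsZero D.L₀.X₃ := isZero_kernel_of_mono g
    exact this.eq_of_src _ _)).1 D.L₂'_exact
  have he : Epi (cokernel.map (f ≫ g) g f (𝟙 _) (by simp)) := by
    have h : cokernel.π (f ≫ g) ≫ cokernel.map (f ≫ g) g f (𝟙 _) (by simp) = cokernel.π g :=
      (cokernel.π_desc _ _ _).trans (Category.id_comp _)
    exact epi_of_epi_fac h
  exact ⟨D.L₃.zero, { exact := D.L₃_exact, mono_f := hm, epi_g := he }⟩

/-- The subobjects of objects of `P` whose quotient lies in `P`. -/
def kernelClosure (P : ObjectProperty A) : ObjectProperty A :=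
  fun X => ∃ (E : A) (i : X ⟶ E), Mono i ∧ P E ∧ P (cokernel i)

theorem le_kernelClosure (P : ObjectProperty A) [IsNarrow P] : P ≤ kernelClosure P := fun X hX =>
  have := isClosedUnderIsomorphisms_of_isNarrow P
  ⟨X, 𝟙 X, inferInstance, hX, P.prop_of_isZero (isZero_cokernel_of_epi _)⟩

theorem kernelClosure_of_iso (P : ObjectProperty A) [IsNarrow P] {X Y : A} (e : X ≅ Y)
    (hX : kernelClosure P X) : kernelClosure P Y := by
  have := isClosedUnderIsomorphisms_of_isNarrow P
  obtain ⟨E, i, hi, h₁, h₂⟩ := hX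
  exact ⟨E, e.inv ≫ i, inferInstance, h₁, P.prop_of_iso (cokernelEpiComp _ _).symm h₂⟩

theorem kernelClosure_kernel_of_epi (P : ObjectProperty A) [IsNarrow P] {X Y : A} (f : X ⟶ Y)
    [Epi f] (hX : P X) (hY : P Y) : kernelClosure P (kernel f) := by
  have := isClosedUnderIsomorphisms_of_isNarrow P
  exact ⟨X, kernel.ι f, inferInstance, hX,
    P.prop_of_iso ((Abelian.epiIsCokernelOfKernel _ (limit.isLimit _)).coconePointUniqueUpToIso
      (colimit.isColimit _)) hY⟩

theorem le_wideClosure (P : ObjectProperty A) : P ≤ wideClosure P := fun _ hX _ _ h => h _ hX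

variable [HasDerivedCategory.{w} A]

/-- The extension of `coker f` by `im f` with middle term `Y` lifts along `X ↠ im f` to an extension
`E` of `coker f` by `X`. Then `E` is in `P` and `E → Y` is an epimorphism with the same kernel as
`f`. -/
theorem kernelClosure_kernel_of_prop (hA : ExtTwoVanishes A) (P : ObjectProperty A) [IsNarrow P]
    {X Y : A} (f : X ⟶ Y) (hX : P X) (hY : P Y) : kernelClosure P (kernel f) := by
  have hS : (ShortComplex.mk (image.ι f) (cokernel.π (image.ι f))
      (cokernel.condition _)).ShortExact := { exact := ShortComplex.exact_cokernel _ }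
  obtain ⟨E, i, p, w, b, hE, h₁, h₂⟩ := exists_extension_of_epi hA hS (factorThruImage f)
  have := hE.mono_f
  have := hE.epi_g
  dsimp at h₁ h₂ this
  have hc : P (cokernel (image.ι f)) := by
    have := isClosedUnderIsomorphisms_of_isNarrow P
    have e : cokernel f ≅ cokernel (image.ι f) :=
      cokernelIsoOfEq (image.fac f).symm ≪≫ cokernelEpiComp (factorThruImage f) (image.ι f)
    exact P.prop_of_iso e (P.prop_cokernel f hX hY)
  have hPE : P E := P.prop_X₂_of_shortExact hE hX hc
  have hb : Epi b := by
    refine Preadditive.epi_of_cancel_zero _ fun {Z} z hz => ?_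
    have h₃ : image.ι f ≫ z = 0 := by
      rw [← cancel_epi (factorThruImage f), ← reassoc_of% h₁, hz, comp_zero, comp_zero]
    rw [← cokernel.π_desc _ z h₃, ← Category.assoc, h₂] at hz
    rw [← cokernel.π_desc _ z h₃, (cancel_epi p).1 (hz.trans comp_zero.symm), comp_zero]
  refine kernelClosure_of_iso P ?_ (kernelClosure_kernel_of_epi P b hPE hY)
  exact (kernelIsoOfComm hE h₁ h₂).symm ≪≫
    (kernelCompMono (factorThruImage f) (image.ι f)).symm ≪≫ kernelIsoOfEq (image.fac f)

theorem isWide_kernelClosure (hA : ExtTwoVanishes A) (P : ObjectProperty A) [IsNarrow P] :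
    IsWide (kernelClosure P) := by
  have := isClosedUnderIsomorphisms_of_isNarrow P
  refine { exists_zero := ?_, kernels_le := ?_, cokernels_le := ?_, prop_X₂_of_shortExact := ?_ }
  · exact ⟨_, isZero_zero A, le_kernelClosure P _ (P.prop_of_isZero (isZero_zero A))⟩
  -- Kernels: push `i` out along `f ≫ j`. The map `b : E' → Q` is between objects of `P` and has the
  -- kernel of `f ≫ j`, which is that of `f`.
  · rintro _ ⟨f, k, hk, ⟨E', i, hi, hE', hi'⟩, ⟨E, j, hj, hE, hj'⟩⟩
    obtain ⟨Q, u, p, w, b, hQ, sq, h⟩ := exists_pushforward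
      (S := ShortComplex.mk i (cokernel.π i) (cokernel.condition i))
      { exact := ShortComplex.exact_cokernel i } (f ≫ j)
    have := hQ.mono_f
    dsimp at this sq h
    refine kernelClosure_of_iso P ?_ (kernelClosure_kernel_of_prop hA P b hE'
      (P.prop_X₂_of_shortExact hQ hE hi'))
    exact (kernelIsoOfComm (S := ShortComplex.mk i (cokernel.π i) (cokernel.condition i))
      { exact := ShortComplex.exact_cokernel i } sq.w h).symm ≪≫ kernelCompMono f j ≪≫
      (kernelIsKernel f).conePointUniqueUpToIso hk
  -- Cokernels: the same pushout puts `coker (f ≫ j) ≅ coker b` in `P`, and `coker f` embeds in it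
  -- with quotient `coker j`.
  · rintro _ ⟨f, k, hk, ⟨E', i, hi, hE', hi'⟩, ⟨E, j, hj, hE, hj'⟩⟩
    obtain ⟨Q, u, p, w, b, hQ, sq, h⟩ := exists_pushforward
      (S := ShortComplex.mk i (cokernel.π i) (cokernel.condition i))
      { exact := ShortComplex.exact_cokernel i } (f ≫ j)
    have := isIso_cokernel_map_of_isPushout sq.flip
    have hc : P (cokernel (f ≫ j)) :=
      P.prop_of_iso (asIso (cokernel.map _ _ _ _ sq.flip.w)).symm
        (P.prop_cokernel b hE' (P.prop_X₂_of_shortExact hQ hE hi'))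
    obtain ⟨w', hw⟩ := exists_shortExact_cokernel_comp f j
    have := hw.mono_f
    have := hw.epi_g
    refine kernelClosure_of_iso P ((cokernelIsCokernel f).coconePointUniqueUpToIso hk)
      ⟨_, cokernel.map f (f ≫ j) (𝟙 _) j (by simp), hw.mono_f, hc, P.prop_of_iso ?_ hj'⟩
    exact hw.gIsCokernel.coconePointUniqueUpToIso (colimit.isColimit _)
  -- Extensions: push out along `i`, then extend along `j`. This embeds the middle term in an object
  -- `Q'` of `P`, with quotient an extension of `coker j` by `coker i`.
  · rintro S hS ⟨E, i, hi, hE, hi'⟩ ⟨E', j, hj, hE', hj'⟩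
    obtain ⟨Q, u, p, w, b, hQ, sq, h⟩ := exists_pushforward hS i
    obtain ⟨Q', u', p', w', b', hQ', h₁, h₂⟩ := exists_extension_of_mono hA hQ j
    have := hS.mono_f
    have := hQ.mono_f
    have := hQ.epi_g
    have := hQ'.epi_g
    have := isIso_cokernel_map_of_isPushout sq.flip
    dsimp at *
    have e : cokernel b' ≅ cokernel j := cokernelIsoOfComm hQ' h₂ h₁
    have hb : Mono b := Preadditive.mono_of_isZero_kernel _
      ((isZero_kernel_of_mono i).of_iso (kernelIsoOfComm hS sq.w h).symm)
    have hb' : Mono b' := by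
      refine Preadditive.mono_of_cancel_zero _ fun {Z} z hz => ?_
      have h₃ : z ≫ p = 0 := by
        rw [← cancel_mono j, Category.assoc, ← h₂, reassoc_of% hz, zero_comp, zero_comp]
      rw [← hQ.exact.lift_f z h₃] at hz ⊢
      have h₄ : hQ.exact.lift z h₃ ≫ u' = 0 := by
        rw [← h₁]
        simpa using hz
      have := hQ'.mono_f
      rw [(cancel_mono u').1 (h₄.trans zero_comp.symm), zero_comp]
    obtain ⟨w'', hw⟩ := exists_shortExact_cokernel_comp b b'
    refine ⟨Q', b ≫ b', inferInstance, P.prop_X₂_of_shortExact hQ' hE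
      (by assumption), P.prop_X₂_of_shortExact hw ?_ (P.prop_of_iso e.symm hj')⟩
    exact P.prop_of_iso (asIso (cokernel.map _ _ _ _ sq.flip.w)) hi'

theorem wideClosure_eq_kernelClosure (hA : ExtTwoVanishes A) (P : ObjectProperty A) [IsNarrow P] :
    wideClosure P = kernelClosure P := by
  apply le_antisymm
  · exact fun X hX => hX _ (isWide_kernelClosure hA P) (le_kernelClosure P)
  · rintro X ⟨E, i, hi, h₁, h₂⟩ W hW hP
    have hS : (ShortComplex.mk i (cokernel.π i) (cokernel.condition i)).ShortExact :=
      { exact := ShortComplex.exact_cokernel i }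
    exact W.prop_of_isLimit_kernelFork hS.fIsKernel (hP _ h₁) (hP _ h₂)

/-- A narrow subcategory is closed under those quotients lying in its wide closure. -/
theorem prop_of_epi_of_wideClosure (hA : ExtTwoVanishes A) (P : ObjectProperty A) [IsNarrow P]
    {X Y : A} (q : X ⟶ Y) [Epi q] (hX : P X) (hY : wideClosure P Y) : P Y := by
  have := isClosedUnderIsomorphisms_of_isNarrow P
  have hK : wideClosure P (kernel q) :=
    (wideClosure P).prop_kernel q (le_wideClosure P _ hX) hY
  rw [wideClosure_eq_kernelClosure hA] at hK
  obtain ⟨E, i, hi, hE, hi'⟩ := hK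
  -- The kernel `K` of `q` embeds in `E` with `E/K` in `P`. The pushout `Q` of `E` and `X` over `K`
  -- extends `E/K` by `X`, so it is in `P`, and `Y ≅ X/K ≅ coker (E → Q)`.
  obtain ⟨Q, u, p, w, b, hQ, sq, h⟩ := exists_pushforward
    (S := ShortComplex.mk i (cokernel.π i) (cokernel.condition i))
    { exact := ShortComplex.exact_cokernel i } (kernel.ι q)
  have := isIso_cokernel_map_of_isPushout sq.flip
  refine P.prop_of_iso ?_ (P.prop_cokernel b hE (P.prop_X₂_of_shortExact hQ hX hi'))
  exact (asIso (cokernel.map _ _ _ _ sq.flip.w)).symm ≪≫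
    (colimit.isColimit _).coconePointUniqueUpToIso
      (Abelian.epiIsCokernelOfKernel _ (limit.isLimit _))

end Abelian

/-! ### Homology, stalk complexes and truncation in `D^b A`. -/

section Bounded

open DerivedCategory Pretriangulated ZeroObject

variable (A : Type u) [Category.{v} A] [Abelian A] [HasDerivedCategory.{w} A]

theorem bounded_singleFunctor_obj (M : A) :
    (DerivedCategory.TStructure.t (C := A)).bounded ((singleFunctor A 0).obj M) :=
  ⟨⟨0, inferInstanceAs (IsGE ((singleFunctor A 0).obj M) 0)⟩,
    ⟨0, inferInstanceAs (IsLE ((singleFunctor A 0).obj M) 0)⟩⟩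

/-- The objects of `A`, considered as complexes concentrated in degree zero. -/
def single : A ⥤ Bounded A :=
  ObjectProperty.lift _ (singleFunctor A 0) (bounded_singleFunctor_obj A)

/-- The objects of `A`, considered as complexes with homology concentrated in degree `k`. -/
def stalk (k : ℤ) : A ⥤ Bounded A := single A ⋙ shiftFunctor (Bounded A) k

/-- The compatibility of homology with shifts. -/
def homologyShiftIso (a k j : ℤ) (h : j + a = k) :
    shiftFunctor (Bounded A) a ⋙ homology A k ≅ homology A j :=
  Functor.isoWhiskerRight (Bounded.ι.commShiftIso a) (homologyFunctor A (-k)) ≪≫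
    Functor.isoWhiskerLeft Bounded.ι
      ((homologyFunctor A 0).shiftIso a (-k) (-j) (by lia))

def singleHomologyIso : single A ⋙ homology A 0 ≅ 𝟭 A :=
  singleFunctorCompHomologyFunctorIso A 0

/-- The homology of `stalk A k` in degree `k`. -/
def stalkHomologyIso (k : ℤ) : stalk A k ⋙ homology A k ≅ 𝟭 A :=
  Functor.isoWhiskerLeft (single A) (homologyShiftIso A k k 0 (by lia)) ≪≫ singleHomologyIso A

variable {A}

instance (k : ℤ) : (homology A k).Additive := by unfold homology; infer_instance

theorem isLE_obj_iff (X : Bounded A) (n : ℤ) :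
    X.obj.IsLE n ↔ ∀ k : ℤ, k < -n → IsZero ((homology A k).obj X) := by
  rw [isLE_iff]
  refine ⟨fun h k hk => h _ (by lia), fun h k hk => ?_⟩
  obtain ⟨k, rfl⟩ : ∃ j, k = -j := ⟨-k, by lia⟩
  exact h k (by lia)

theorem isGE_obj_iff (X : Bounded A) (n : ℤ) :
    X.obj.IsGE n ↔ ∀ k : ℤ, -n < k → IsZero ((homology A k).obj X) := by
  rw [isGE_iff]
  refine ⟨fun h k hk => h _ (by lia), fun h k hk => ?_⟩
  obtain ⟨k, rfl⟩ : ∃ j, k = -j := ⟨-k, by lia⟩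
  exact h k (by lia)

theorem exists_homology_bounds (X : Bounded A) : ∃ a b : ℤ, ∀ k, k < a ∨ b < k →
    IsZero ((homology A k).obj X) := by
  obtain ⟨⟨b, hb⟩, ⟨a, ha⟩⟩ := X.property
  have ha' := (isLE_obj_iff X a).1 ha
  have hb' := (isGE_obj_iff X b).1 hb
  exact ⟨-a, -b, fun k hk => hk.elim (ha' k) (hb' k)⟩

theorem isIso_iff_homology {X Y : Bounded A} (f : X ⟶ Y) :
    IsIso f ↔ ∀ k, IsIso ((homology A k).map f) := by
  refine ⟨fun _ _ => inferInstance, fun h => ?_⟩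
  rw [← isIso_iff_of_reflects_iso f Bounded.ι, DerivedCategory.isIso_iff]
  intro n
  obtain ⟨k, rfl⟩ : ∃ j, n = -j := ⟨-n, by lia⟩
  exact h k

theorem isZero_iff_homology (X : Bounded A) :
    IsZero X ↔ ∀ k, IsZero ((homology A k).obj X) := by
  refine ⟨fun h k => Functor.map_isZero _ h, fun h => ?_⟩
  have : IsIso (0 : X ⟶ 0) := by
    rw [isIso_iff_homology]
    intro k
    have h' : IsZero ((homology A k).obj (0 : Bounded A)) := Functor.map_isZero _ (isZero_zero _)
    exact ⟨0, (h k).eq_of_src _ _, h'.eq_of_src _ _⟩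
  exact (isZero_zero _).of_iso (asIso (0 : X ⟶ 0))

theorem isZero_homology_shift_iff (X : Bounded A) (a k j : ℤ) (h : j + a = k) :
    IsZero ((homology A k).obj (X⟦a⟧)) ↔ IsZero ((homology A j).obj X) :=
  ((homologyShiftIso A a k j h).app X).isZero_iff

theorem isZero_homology_single (M : A) {k : ℤ} (hk : k ≠ 0) :
    IsZero ((homology A k).obj ((single A).obj M)) := by
  rcases lt_or_gt_of_ne hk with h | h
  · exact (isLE_obj_iff ((single A).obj M) 0).1
      (inferInstanceAs (IsLE ((singleFunctor A 0).obj M) 0)) k (by lia)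
  · exact (isGE_obj_iff ((single A).obj M) 0).1
      (inferInstanceAs (IsGE ((singleFunctor A 0).obj M) 0)) k (by lia)

theorem isZero_homology_stalk (M : A) {k j : ℤ} (hk : j ≠ k) :
    IsZero ((homology A j).obj ((stalk A k).obj M)) :=
  (isZero_homology_shift_iff _ k j (j - k) (by lia)).2 (isZero_homology_single M (by lia))

/-- The connecting morphism of the long exact homology sequence of a distinguished triangle. -/
def IsTri.connecting {X Y Z : Bounded A} {f : X ⟶ Y} {g : Y ⟶ Z} {h : Z ⟶ X⟦(1 : ℤ)⟧}
    (_ : IsTri f g h) (i j : ℤ) (hij : j + 1 = i) : (homology A i).obj Z ⟶ (homology A j).obj X :=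
  HomologySequence.δ (Bounded.ι.mapTriangle.obj (Triangle.mk f g h)) (-i) (-j) (by lia)

namespace IsTri

variable {X Y Z : Bounded A} {f : X ⟶ Y} {g : Y ⟶ Z} {h : Z ⟶ X⟦(1 : ℤ)⟧}

theorem exact₂ (hT : IsTri f g h) (k : ℤ) :
    (ShortComplex.mk ((homology A k).map f) ((homology A k).map g)
      (by rw [← Functor.map_comp, hT.zero₁₂, Functor.map_zero])).Exact :=
  HomologySequence.exact₂ _ (Bounded.ι.map_distinguished _ hT) (-k)

theorem map_comp_connecting (hT : IsTri f g h) (i j : ℤ) (hij : j + 1 = i) :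
    (homology A i).map g ≫ hT.connecting i j hij = 0 :=
  HomologySequence.comp_δ _ (Bounded.ι.map_distinguished _ hT) (-i) (-j) (by lia)

theorem connecting_comp_map (hT : IsTri f g h) (i j : ℤ) (hij : j + 1 = i) :
    hT.connecting i j hij ≫ (homology A j).map f = 0 :=
  HomologySequence.δ_comp _ (Bounded.ι.map_distinguished _ hT) (-i) (-j) (by lia)

theorem exact₃ (hT : IsTri f g h) (i j : ℤ) (hij : j + 1 = i) :
    (ShortComplex.mk _ _ (hT.map_comp_connecting i j hij)).Exact :=
  HomologySequence.exact₃ _ (Bounded.ι.map_distinguished _ hT) (-i) (-j) (by lia)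

theorem exact₁ (hT : IsTri f g h) (i j : ℤ) (hij : j + 1 = i) :
    (ShortComplex.mk _ _ (hT.connecting_comp_map i j hij)).Exact :=
  HomologySequence.exact₁ _ (Bounded.ι.map_distinguished _ hT) (-i) (-j) (by lia)

theorem isZero_homology₂ (hT : IsTri f g h) (k : ℤ) (h₁ : IsZero ((homology A k).obj X))
    (h₃ : IsZero ((homology A k).obj Z)) : IsZero ((homology A k).obj Y) :=
  (hT.exact₂ k).isZero_X₂ (h₁.eq_of_src _ _) (h₃.eq_of_tgt _ _)

theorem isZero_homology₃ (hT : IsTri f g h) (i j : ℤ) (hij : j + 1 = i)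
    (h₂ : IsZero ((homology A i).obj Y)) (h₁ : IsZero ((homology A j).obj X)) :
    IsZero ((homology A i).obj Z) :=
  (hT.exact₃ i j hij).isZero_X₂ (h₂.eq_of_src _ _) (h₁.eq_of_tgt _ _)

theorem isIso_homology₁ (hT : IsTri f g h) (i j : ℤ) (hij : j + 1 = i)
    (h₃ : IsZero ((homology A i).obj Z)) (h₃' : IsZero ((homology A j).obj Z)) :
    IsIso ((homology A j).map f) := by
  have := (hT.exact₁ i j hij).mono_g (h₃.eq_of_src _ _)
  have := (hT.exact₂ j).epi_f (h₃'.eq_of_tgt _ _)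
  dsimp at *
  exact isIso_of_mono_of_epi _

theorem isIso_homology₂ (hT : IsTri f g h) (i j : ℤ) (hij : j + 1 = i)
    (h₁ : IsZero ((homology A i).obj X)) (h₁' : IsZero ((homology A j).obj X)) :
    IsIso ((homology A i).map g) := by
  have := (hT.exact₂ i).mono_g (h₁.eq_of_src _ _)
  have := (hT.exact₃ i j hij).epi_f (h₁'.eq_of_tgt _ _)
  dsimp at *
  exact isIso_of_mono_of_epi _

end IsTri

/-- Truncation: `X'` has homology in degrees at least `n` and `X''` in degrees less than `n`. -/
theorem exists_truncation (X : Bounded A) (n : ℤ) :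
    ∃ (X' X'' : Bounded A) (f : X' ⟶ X) (g : X ⟶ X'') (h : X'' ⟶ X'⟦(1 : ℤ)⟧),
      IsTri f g h ∧ (∀ k < n, IsZero ((homology A k).obj X')) ∧
      (∀ k, n ≤ k → IsZero ((homology A k).obj X'')) ∧
      (∀ k, n ≤ k → IsIso ((homology A k).map f)) ∧
      (∀ k < n, IsIso ((homology A k).map g)) := by
  obtain ⟨X', X'', h', h'', f, g, h, hT⟩ :=
    (DerivedCategory.TStructure.t.bounded.tStructure
      DerivedCategory.TStructure.t).exists_triangle X (-n) (1 - n) (by lia)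
  replace hT : IsTri f g h := hT
  have h₁ := (isLE_obj_iff X' (-n)).1 ⟨h'⟩
  have h₂ := (isGE_obj_iff X'' (1 - n)).1 ⟨h''⟩
  exact ⟨X', X'', f, g, h, hT, fun k hk => h₁ k (by lia), fun k hk => h₂ k (by lia),
    fun k hk => hT.isIso_homology₁ (k + 1) k rfl (h₂ _ (by lia)) (h₂ _ (by lia)),
    fun k hk => hT.isIso_homology₂ k (k - 1) (by lia) (h₁ _ (by lia)) (h₁ _ (by lia))⟩

theorem exists_iso_stalk (X : Bounded A) (n : ℤ)
    (h : ∀ k, k ≠ n → IsZero ((homology A k).obj X)) :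
    ∃ M : A, Nonempty (X ≅ (stalk A n).obj M) := by
  have h₀ (k : ℤ) (hk : k ≠ 0) : IsZero ((homology A k).obj (X⟦-n⟧)) :=
    (isZero_homology_shift_iff X (-n) k (k + n) (by lia)).2 (h _ (by lia))
  have := (isLE_obj_iff (X⟦-n⟧) 0).2 fun k hk => h₀ k (by lia)
  have := (isGE_obj_iff (X⟦-n⟧) 0).2 fun k hk => h₀ k (by lia)
  obtain ⟨M, ⟨e⟩⟩ := exists_iso_singleFunctor_obj_of_isGE_of_isLE (X⟦-n⟧).obj 0
  let e' : X⟦-n⟧ ≅ (single A).obj M := Bounded.ι.preimageIso e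
  exact ⟨M, ⟨(shiftEquiv (Bounded A) n).counitIso.symm.app X ≪≫
    (shiftFunctor (Bounded A) n).mapIso e'⟩⟩

theorem exists_iso_stalk_homology (X : Bounded A) (n : ℤ)
    (h : ∀ k, k ≠ n → IsZero ((homology A k).obj X)) :
    Nonempty (X ≅ (stalk A n).obj ((homology A n).obj X)) := by
  obtain ⟨M, ⟨e⟩⟩ := exists_iso_stalk X n h
  exact ⟨e ≪≫ (stalk A n).mapIso (((stalkHomologyIso A n).symm.app M) ≪≫
    (homology A n).mapIso e.symm)⟩

/-- Dévissage of a bounded complex along its truncations. -/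
theorem devissage (P : Bounded A → Prop) (X : Bounded A)
    (zero : ∀ Y, IsZero Y → P Y)
    (conc : ∀ (n : ℤ) (Y : Bounded A), (∀ k, k ≠ n → IsZero ((homology A k).obj Y)) →
      Nonempty ((homology A n).obj Y ≅ (homology A n).obj X) → P Y)
    (ext : ∀ (n : ℤ) (X₁ X₂ X₃ : Bounded A) (f : X₁ ⟶ X₂) (g : X₂ ⟶ X₃) (h : X₃ ⟶ X₁⟦(1 : ℤ)⟧),
      IsTri f g h → (∀ k < n, IsZero ((homology A k).obj X₁)) →
      (∀ k, n ≤ k → IsZero ((homology A k).obj X₃)) → P X₁ → P X₃ → P X₂) : P X := by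
  obtain ⟨a, b, hX⟩ := exists_homology_bounds X
  have key (m : ℕ) : ∀ Y : Bounded A, (∀ k, k < a ∨ a + m ≤ k → IsZero ((homology A k).obj Y)) →
      (∀ k, k < a + m → Nonempty ((homology A k).obj Y ≅ (homology A k).obj X)) → P Y := by
    induction m with
    | zero => exact fun Y hY _ => zero Y ((isZero_iff_homology Y).2 fun k => hY k (by grind))
    | succ m ih =>
      intro Y hY hYX
      obtain ⟨Y₁, Y₂, f, g, h, hT, h₁, h₂, h₃, h₄⟩ := exists_truncation Y (a + m)
      refine ext (a + m) _ _ _ f g h hT h₁ h₂ (conc (a + m) Y₁ (fun k hk => ?_) ?_)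
        (ih Y₂ (fun k hk => ?_) (fun k hk => ?_))
      · rcases lt_or_gt_of_ne hk with hk | hk
        · exact h₁ k hk
        · have := h₃ k hk.le
          exact (hY k (Or.inr (by push_cast; lia))).of_iso (asIso ((homology A k).map f))
      · have := h₃ (a + m) le_rfl
        obtain ⟨e⟩ := hYX (a + m) (by push_cast; lia)
        exact ⟨asIso ((homology A (a + m)).map f) ≪≫ e⟩
      · rcases hk with hk | hk
        · have := h₄ k (by lia)
          exact (hY k (Or.inl hk)).of_iso (asIso ((homology A k).map g)).symm
        · exact h₂ k hk
      · have := h₄ k hk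
        obtain ⟨e⟩ := hYX k (by push_cast; lia)
        exact ⟨(asIso ((homology A k).map g)).symm ≪≫ e⟩
  -- If `b + 1 < a` the truncation to `ℕ` gives `0`; in every case `a + m` is at least `b + 1`.
  refine key (b + 1 - a).toNat X (fun k hk => hX k ?_) (fun k hk => ⟨Iso.refl _⟩)
  have := Int.self_le_toNat (b + 1 - a)
  lia

end Bounded

/-! ### Five-term exact sequences. -/

section FiveTerm

variable {A : Type u} [Category.{v} A] [Abelian A]

theorem exact_mk₄ {X₀ X₁ X₂ X₃ X₄ : A} {f : X₀ ⟶ X₁} {g : X₁ ⟶ X₂} {h : X₂ ⟶ X₃} {i : X₃ ⟶ X₄}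
    {w₁ : f ≫ g = 0} {w₂ : g ≫ h = 0} {w₃ : h ≫ i = 0} (h₁ : (ShortComplex.mk f g w₁).Exact)
    (h₂ : (ShortComplex.mk g h w₂).Exact) (h₃ : (ShortComplex.mk h i w₃).Exact) :
    (ComposableArrows.mk₄ f g h i).Exact :=
  ComposableArrows.exact_of_δ₀ (ComposableArrows.exact₂_mk _ w₁ h₁)
    (ComposableArrows.exact_of_δ₀ (ComposableArrows.exact₂_mk _ w₂ h₂)
      (ComposableArrows.exact₂_mk _ w₃ h₃))

/-- The middle term of a five term exact sequence is an extension of a kernel by a cokernel. -/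
theorem exists_shortExact_of_exact {X₀ X₁ X₂ X₃ X₄ : A} {f : X₀ ⟶ X₁} {g : X₁ ⟶ X₂} {h : X₂ ⟶ X₃}
    {i : X₃ ⟶ X₄} (H : (ComposableArrows.mk₄ f g h i).Exact) :
    ∃ (a : cokernel f ⟶ X₂) (b : X₂ ⟶ kernel i) (w : a ≫ b = 0),
      (ShortComplex.mk a b w).ShortExact := by
  have w₁ : f ≫ g = 0 := H.toIsComplex.zero 0
  have w₂ : g ≫ h = 0 := H.toIsComplex.zero 1
  have w₃ : h ≫ i = 0 := H.toIsComplex.zero 2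
  have h₁ : (ShortComplex.mk f g w₁).Exact := H.exact 0
  have h₂ : (ShortComplex.mk g h w₂).Exact := H.exact 1
  have h₃ : (ShortComplex.mk h i w₃).Exact := H.exact 2
  have hm : Mono (cokernel.desc f g w₁) := h₁.mono_cokernelDesc
  have he : Epi (kernel.lift i h w₃) := h₃.epi_kernelLift
  have w : cokernel.desc f g w₁ ≫ kernel.lift i h w₃ = 0 := by
    rw [← cancel_mono (kernel.ι i), ← cancel_epi (cokernel.π f)]
    simp [w₂]
  refine ⟨cokernel.desc f g w₁, kernel.lift i h w₃, w, { exact := ?_ }⟩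
  rw [ShortComplex.exact_iff_exact_up_to_refinements] at h₂ ⊢
  intro T x hx
  obtain ⟨T', π, hπ, y, hy⟩ := h₂ x (by
    dsimp at hx ⊢
    simpa using hx =≫ kernel.ι i)
  exact ⟨T', π, hπ, y ≫ cokernel.π f, by simpa using hy⟩

theorem prop_of_exact_of_isWide (W : ObjectProperty A) [IsWide W] {X₀ X₁ X₂ X₃ X₄ : A}
    {f : X₀ ⟶ X₁} {g : X₁ ⟶ X₂} {h : X₂ ⟶ X₃} {i : X₃ ⟶ X₄}
    (H : (ComposableArrows.mk₄ f g h i).Exact) (h₀ : W X₀) (h₁ : W X₁) (h₃ : W X₃) (h₄ : W X₄) :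
    W X₂ := by
  obtain ⟨a, b, w, hS⟩ := exists_shortExact_of_exact H
  exact W.prop_X₂_of_shortExact hS (W.prop_cokernel f h₀ h₁) (W.prop_kernel i h₃ h₄)

end FiveTerm

/-! ### Splitting over a hereditary category. -/

section Bounded

open DerivedCategory Pretriangulated ZeroObject

variable {A : Type u} [Category.{v} A] [Abelian A] [HasDerivedCategory.{w} A]

namespace IsTri

variable {X Y Z : Bounded A} {f : X ⟶ Y} {g : Y ⟶ Z} {h : Z ⟶ X⟦(1 : ℤ)⟧}

theorem exact_homology₂ (hT : IsTri f g h) (i j k : ℤ) (hij : j + 1 = i) (hjk : k + 1 = j) :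
    (ComposableArrows.mk₄ (hT.connecting i j hij) ((homology A j).map f) ((homology A j).map g)
      (hT.connecting j k hjk)).Exact :=
  exact_mk₄ (hT.exact₁ i j hij) (hT.exact₂ j) (hT.exact₃ j k hjk)

end IsTri

/-- Shifting stalk complexes. -/
def stalkShiftIso (k a j : ℤ) (h : k + a = j) :
    stalk A k ⋙ shiftFunctor (Bounded A) a ≅ stalk A j :=
  Functor.isoWhiskerLeft (single A) (shiftFunctorAdd' (Bounded A) k a j h).symm

instance : (single A).Full := by unfold single; infer_instance
instance : (single A).Faithful := by unfold single; infer_instance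
instance (k : ℤ) : (stalk A k).Full := by unfold stalk; infer_instance
instance (k : ℤ) : (stalk A k).Faithful := by unfold stalk; infer_instance
instance : (single A).Additive := by unfold single; infer_instance
instance (k : ℤ) : (stalk A k).Additive := by unfold stalk; infer_instance

theorem hom_eq_zero_of_lt {X Y : Bounded A} (n : ℤ) (hX : ∀ k < n, IsZero ((homology A k).obj X))
    (hY : ∀ k, n ≤ k → IsZero ((homology A k).obj Y)) (f : X ⟶ Y) : f = 0 := by
  have : TStructure.t.IsLE (Bounded.ι.obj X) (-n) :=
    (isLE_obj_iff X (-n)).2 fun k hk => hX k (by lia)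
  have : TStructure.t.IsGE (Bounded.ι.obj Y) (1 - n) :=
    (isGE_obj_iff Y (1 - n)).2 fun k hk => hY k (by lia)
  exact Bounded.ι.map_injective (DerivedCategory.TStructure.t.zero _ (-n) (1 - n) (by lia))

theorem hom_single_shift_eq_zero (hA : ExtTwoVanishes A) {n : ℤ} (hn : 2 ≤ n) {M N : A}
    (f : (single A).obj M ⟶ ((single A).obj N)⟦n⟧) : f = 0 := by
  apply Bounded.ι.map_injective
  rw [← cancel_mono ((Bounded.ι.commShiftIso n).hom.app ((single A).obj N)), Functor.map_zero,
    zero_comp]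
  exact hom_shift_eq_zero hA hn _

theorem hom_stalk_eq_zero (hA : ExtTwoVanishes A) {i j : ℤ} (hij : i + 2 ≤ j) {M N : A}
    (f : (stalk A i).obj M ⟶ (stalk A j).obj N) : f = 0 := by
  let e : (stalk A j).obj N ≅ (shiftFunctor (Bounded A) i).obj (((single A).obj N)⟦j - i⟧) :=
    (shiftFunctorAdd' (Bounded A) (j - i) i j (by lia)).app ((single A).obj N)
  obtain ⟨g, hg⟩ := (shiftFunctor (Bounded A) i).map_surjective (f ≫ e.hom)
  rw [hom_single_shift_eq_zero hA (by lia) g, Functor.map_zero] at hg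
  exact (cancel_mono e.hom).1 (hg.symm.trans zero_comp.symm)

/-- Dévissage in both variables reduces to stalk complexes whose degrees differ by at least two. -/
theorem hom_eq_zero_of_add_two_le (hA : ExtTwoVanishes A) {X Y : Bounded A} (n : ℤ)
    (hX : ∀ k, n < k → IsZero ((homology A k).obj X))
    (hY : ∀ k < n + 2, IsZero ((homology A k).obj Y)) (f : X ⟶ Y) : f = 0 := by
  revert f
  refine devissage (fun X' => ∀ f : X' ⟶ Y, f = 0) X (fun _ h _ => h.eq_of_src _ _) ?_ ?_
  · rintro i X' hX' ⟨e⟩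
    by_cases hi : n < i
    · have : IsZero X' := (isZero_iff_homology _).2 fun k => by
        by_cases hk : k = i
        · subst hk
          exact (hX k hi).of_iso e
        · exact hX' k hk
      exact fun f => this.eq_of_src _ _
    · obtain ⟨M, ⟨e'⟩⟩ := exists_iso_stalk X' i hX'
      suffices ∀ f : (stalk A i).obj M ⟶ Y, f = 0 by
        intro f
        rw [← cancel_epi e'.inv, this (e'.inv ≫ f), comp_zero]
      refine devissage (fun Y' => ∀ f : (stalk A i).obj M ⟶ Y', f = 0) Y
        (fun _ h _ => h.eq_of_tgt _ _) ?_ ?_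
      · rintro j Y' hY' ⟨e⟩ f
        by_cases hj : j < n + 2
        · have : IsZero Y' := (isZero_iff_homology _).2 fun k => by
            by_cases hk : k = j
            · subst hk
              exact (hY k hj).of_iso e
            · exact hY' k hk
          exact this.eq_of_tgt _ _
        · obtain ⟨N, ⟨e''⟩⟩ := exists_iso_stalk Y' j hY'
          rw [← cancel_mono e''.hom, hom_stalk_eq_zero hA (by lia) (f ≫ e''.hom), zero_comp]
      · intro _ _ _ _ _ _ _ hT _ _ h₁ h₃ f
        obtain ⟨g, rfl⟩ := hT.coyoneda₂ f (h₃ _)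
        rw [h₁ g, zero_comp]
  · intro _ _ _ _ _ _ _ hT _ _ h₁ h₃ f
    obtain ⟨g, rfl⟩ := hT.yoneda₂ f (h₁ _)
    rw [h₃ g, comp_zero]

/-- The shift of `X` creates the gap of two between the homology of `Y` and that of `X[1]`. -/
theorem truncation_splits (hA : ExtTwoVanishes A) {X Y : Bounded A} {n : ℤ}
    (hX : ∀ k < n, IsZero ((homology A k).obj X))
    (hY : ∀ k, n ≤ k → IsZero ((homology A k).obj Y)) (h : Y ⟶ X⟦(1 : ℤ)⟧) : h = 0 :=
  hom_eq_zero_of_add_two_le hA (n - 1) (fun k hk => hY k (by lia))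
    (fun k hk => (isZero_homology_shift_iff X 1 k (k - 1) (by lia)).2 (hX _ (by lia))) h

/-- Over a hereditary category, dévissage only involves split triangles. -/
theorem devissage_split (hA : ExtTwoVanishes A) (P : Bounded A → Prop) (X : Bounded A)
    (zero : ∀ Y, IsZero Y → P Y)
    (conc : ∀ (n : ℤ) (Y : Bounded A), (∀ k, k ≠ n → IsZero ((homology A k).obj Y)) →
      Nonempty ((homology A n).obj Y ≅ (homology A n).obj X) → P Y)
    (ext : ∀ (X₁ X₂ X₃ : Bounded A) (f : X₁ ⟶ X₂) (g : X₂ ⟶ X₃),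
      IsTri f g 0 → P X₁ → P X₃ → P X₂) : P X :=
  devissage P X zero conc fun n X₁ X₂ X₃ f g h hT h₁ h₃ hP₁ hP₃ => by
    obtain rfl := truncation_splits hA h₁ h₃ h
    exact ext _ _ _ _ _ hT hP₁ hP₃

/-- Over a hereditary category, `X` contains its homology as a direct summand. -/
theorem exists_stalk_summand (hA : ExtTwoVanishes A) (X : Bounded A) (k : ℤ) :
    ∃ (M : A) (s : (stalk A k).obj M ⟶ X) (r : X ⟶ (stalk A k).obj M),
      s ≫ r = 𝟙 _ ∧ IsIso ((homology A k).map s) := by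
  -- Truncating at `k` and then at `k + 1` isolates the homology in degree `k`; both triangles
  -- split, which supplies `r` and `s`.
  obtain ⟨X₁, X₂, f, g, h, hT, h₁, h₂, h₃, h₄⟩ := exists_truncation X k
  obtain ⟨r, -, hr, -⟩ := hT.split (truncation_splits hA h₁ h₂ h)
  obtain ⟨X₃, X₄, f', g', h', hT', h₁', h₂', h₃', h₄'⟩ := exists_truncation X₁ (k + 1)
  obtain ⟨-, s, -, hs, -⟩ := hT'.split (truncation_splits hA h₁' h₂' h')
  obtain ⟨M, ⟨e⟩⟩ := exists_iso_stalk X₄ k (fun j hj => by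
    rcases lt_or_gt_of_ne hj with hj | hj
    · have := h₄' j (by lia)
      exact (h₁ j hj).of_iso (asIso ((homology A j).map g')).symm
    · exact h₂' j hj)
  refine ⟨M, e.inv ≫ s ≫ f, r ≫ g' ≫ e.hom, by simp [reassoc_of% hr, reassoc_of% hs], ?_⟩
  have := h₃ k le_rfl
  have := h₄' k (by lia)
  have : IsIso ((homology A k).map s) := by
    have h : IsIso ((homology A k).map s ≫ (homology A k).map g') := by
      rw [← Functor.map_comp, hs]
      infer_instance
    exact IsIso.of_isIso_comp_right _ ((homology A k).map g')
  rw [Functor.map_comp, Functor.map_comp]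
  infer_instance

end Bounded

/-! ### A criterion for coreflectivity. -/

section Coreflective

variable {A : Type u} [Category.{v} A] [Abelian A]

theorem isCoreflective_of_forall {P : ObjectProperty A}
    (h : ∀ Y : A, ∃ (X : A) (e : X ⟶ Y), P X ∧
      (∀ (Z : A) (_ : P Z) (f : Z ⟶ Y), ∃ g : Z ⟶ X, g ≫ e = f) ∧
      (∀ (Z : A) (_ : P Z) (g : Z ⟶ X), g ≫ e = 0 → g = 0)) : IsCoreflective P := by
  have (Y : A) : HasTerminal (CostructuredArrow P.ι Y) := by
    obtain ⟨X, e, hX, h₁, h₂⟩ := h Y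
    let T : CostructuredArrow P.ι Y :=
      CostructuredArrow.mk (Y := (⟨X, hX⟩ : P.FullSubcategory)) (show P.ι.obj ⟨X, hX⟩ ⟶ Y from e)
    choose g hg using fun Z : CostructuredArrow P.ι Y => h₁ _ Z.left.property Z.hom
    refine IsTerminal.hasTerminal (X := T) (IsTerminal.ofUniqueHom
      (fun Z => CostructuredArrow.homMk (ObjectProperty.homMk (g Z)) (hg Z)) fun Z m => ?_)
    apply CostructuredArrow.hom_ext
    apply P.ι.map_injective
    rw [← sub_eq_zero]
    refine h₂ _ Z.left.property _ ?_
    rw [Preadditive.sub_comp, sub_eq_zero]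
    exact (CostructuredArrow.w m).trans (hg Z).symm
  exact isLeftAdjoint_of_costructuredArrowTerminals _

end Coreflective

/-! ### From t-structures to narrow sequences. -/

section Aisle

open DerivedCategory Pretriangulated ZeroObject

variable {A : Type u} [Category.{v} A] [Abelian A] [HasDerivedCategory.{w} A]

theorem _root_.CategoryTheory.ShortComplex.ShortExact.exists_isTri_stalk {S : ShortComplex A}
    (hS : S.ShortExact) (k : ℤ) : ∃ δ : (stalk A k).obj S.X₃ ⟶ ((stalk A k).obj S.X₁)⟦(1 : ℤ)⟧,
      IsTri ((stalk A k).map S.f) ((stalk A k).map S.g) δ := by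
  let d : Bounded.ι.obj ((single A).obj S.X₃) ⟶ (Bounded.ι.obj ((single A).obj S.X₁))⟦(1 : ℤ)⟧ :=
    hS.singleδ
  let δ : (single A).obj S.X₃ ⟶ ((single A).obj S.X₁)⟦(1 : ℤ)⟧ :=
    Bounded.ι.preimage (d ≫ (Bounded.ι.commShiftIso (1 : ℤ)).inv.app ((single A).obj S.X₁))
  have h : IsTri ((single A).map S.f) ((single A).map S.g) δ := by
    refine (Bounded.ι.map_distinguished_iff _).1 ?_
    refine hS.isTri.of_iso (Iso.refl _) (Iso.refl _) (Iso.refl _)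
      ((Category.comp_id _).trans (Category.id_comp _).symm)
      ((Category.comp_id _).trans (Category.id_comp _).symm) ?_
    have h : Bounded.ι.map δ ≫ (Bounded.ι.commShiftIso (1 : ℤ)).hom.app ((single A).obj S.X₁) =
        d := by
      rw [Functor.map_preimage, Category.assoc, Iso.inv_hom_id_app]
      exact Category.comp_id _
    refine Eq.trans ?_ (h.symm.trans (Category.id_comp _).symm)
    exact (congrArg _ (CategoryTheory.Functor.map_id _ _)).trans (Category.comp_id _)
  exact h.shift k

variable {t : TStructure (Bounded A)}

/-- Aisles are left orthogonals, and these are stable under retracts. -/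
theorem le_of_retract {X Y : Bounded A} {n : ℤ} (s : X ⟶ Y)
    (r : Y ⟶ X) (h : s ≫ r = 𝟙 X) (hY : t.le n Y) : t.le n X := by
  rw [TStructure.le_iff_isLE, t.isLE_iff_orthogonal n (n + 1) rfl]
  intro Z f hZ
  have : t.IsLE Y n := ⟨hY⟩
  rw [← Category.id_comp f, ← h, Category.assoc, t.zero (r ≫ f) n (n + 1), comp_zero]

theorem le_extension {X Y Z : Bounded A} {f : X ⟶ Y} {g : Y ⟶ Z} {h : Z ⟶ X⟦(1 : ℤ)⟧}
    (hT : IsTri f g h) (n : ℤ) (hX : t.le n X) (hZ : t.le n Z) : t.le n Y :=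
  (t.isLE₂ _ hT n ⟨hX⟩ ⟨hZ⟩).le

theorem le_shift_one {X : Bounded A} (hX : t.le 0 X) : t.le 0 (X⟦(1 : ℤ)⟧) :=
  t.le_monotone (by lia : (-1 : ℤ) ≤ 0) _ (t.le_shift 0 1 (-1) (by lia) _ hX)

/-- The `k`-th homology of an object of the aisle, placed in degree `k`, is a retract of that
object. -/
theorem mu_iff (hA : ExtTwoVanishes A) (k : ℤ) (M : A) :
    mu (t.le 0) k M ↔ t.le 0 ((stalk A k).obj M) := by
  constructor
  · rintro ⟨X, hX, ⟨e⟩⟩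
    obtain ⟨M', s, r, hsr, hs⟩ := exists_stalk_summand hA X k
    exact (t.le 0).prop_of_iso ((stalk A k).mapIso (((stalkHomologyIso A k).symm.app M') ≪≫
      asIso ((homology A k).map s) ≪≫ e)) (le_of_retract s r hsr hX)
  · exact fun h => ⟨_, h, ⟨(stalkHomologyIso A k).app M⟩⟩

instance (k : ℤ) : (mu (t.le 0) k).IsClosedUnderIsomorphisms := by unfold mu; infer_instance

theorem mu_homology {X : Bounded A} (hX : t.le 0 X) (k : ℤ) :
    mu (t.le 0) k ((homology A k).obj X) := ⟨X, hX, ⟨Iso.refl _⟩⟩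

theorem theta_mu (hA : ExtTwoVanishes A) : theta (mu (t.le 0)) = t.le 0 := by
  ext X
  refine ⟨fun hX => ?_, fun hX k => mu_homology hX k⟩
  refine devissage (t.le 0) X (fun Y hY => ?_) ?_ ?_
  · have : t.IsLE Y 0 := by
      rw [t.isLE_iff_orthogonal 0 1 rfl]
      exact fun _ _ _ => hY.eq_of_src _ _
    exact this.le
  · rintro n Y hY ⟨e⟩
    obtain ⟨e'⟩ := exists_iso_stalk_homology Y n hY
    exact (t.le 0).prop_of_iso (e' ≪≫ (stalk A n).mapIso e).symm ((mu_iff hA n _).1 (hX n))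
  · exact fun _ _ _ _ _ _ _ hT _ _ h₁ h₃ => le_extension hT 0 h₁ h₃

/-- The cone of `X[k] → Y[k]` is an extension of `X[k+1]` by `Y[k]`, hence in the aisle, and its
`k`-th homology is the cokernel. Only `X` in degree `k + 1` is needed, which is what the five-term
condition asks for. -/
theorem mu_cokernel (hA : ExtTwoVanishes A) {k : ℤ} {X Y : A} (f : X ⟶ Y)
    (hX : mu (t.le 0) (k + 1) X) (hY : mu (t.le 0) k Y) : mu (t.le 0) k (cokernel f) := by
  rw [mu_iff hA] at hX hY
  obtain ⟨C, g, h, hT⟩ := IsTri.exists_of_mor₁ ((stalk A k).map f)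
  have hC : t.le 0 C := le_extension hT.rot 0 hY
    ((t.le 0).prop_of_iso ((stalkShiftIso k 1 (k + 1) rfl).symm.app X) hX)
  have hg : Epi ((homology A k).map g) := (hT.exact₃ k (k - 1) (by lia)).epi_f
    ((isZero_homology_stalk X (by lia)).eq_of_tgt _ _)
  refine (mu (t.le 0) k).prop_of_iso ?_ (mu_homology hC k)
  exact (hT.exact₂ k).gIsCokernel.coconePointUniqueUpToIso (colimit.isColimit _) ≪≫
    cokernel.mapIso _ _ ((stalkHomologyIso A k).app X) ((stalkHomologyIso A k).app Y)
      ((stalkHomologyIso A k).hom.naturality f)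

/-- The fibre of `X[k] → Y[k]` is an extension of `X[k]` by `Y[k-1]`, and its `k`-th homology is the
kernel. -/
theorem mu_kernel (hA : ExtTwoVanishes A) {k : ℤ} {X Y : A} (f : X ⟶ Y)
    (hX : mu (t.le 0) k X) (hY : mu (t.le 0) (k - 1) Y) : mu (t.le 0) k (kernel f) := by
  rw [mu_iff hA] at hX hY
  let e := (stalkShiftIso (A := A) (k - 1) 1 k (by lia)).app Y
  obtain ⟨F, g, h, hT⟩ := IsTri.exists_of_mor₃ ((stalk A k).map f ≫ e.inv)
  have hF : t.le 0 F := le_extension hT 0 hY hX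
  have hg : Mono ((homology A k).map h) := (hT.exact₂ k).mono_g
    ((isZero_homology_stalk Y (by lia)).eq_of_src _ _)
  refine (mu (t.le 0) k).prop_of_iso ?_ (mu_homology hF k)
  exact (hT.rot.exact₂ k).fIsKernel.conePointUniqueUpToIso (limit.isLimit _) ≪≫
    kernel.mapIso _ _ ((stalkHomologyIso A k).app X)
      ((homology A k).mapIso e ≪≫ (stalkHomologyIso A k).app Y) (by
        have := (stalkHomologyIso A k).hom.naturality f
        simpa using this)

theorem mu_extension (hA : ExtTwoVanishes A) {k : ℤ} {S : ShortComplex A} (hS : S.ShortExact)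
    (h₁ : mu (t.le 0) k S.X₁) (h₃ : mu (t.le 0) k S.X₃) : mu (t.le 0) k S.X₂ := by
  rw [mu_iff hA] at h₁ h₃ ⊢
  obtain ⟨δ, hT⟩ := hS.exists_isTri_stalk k
  exact le_extension hT 0 h₁ h₃

theorem mu_le_succ (hA : ExtTwoVanishes A) (k : ℤ) : mu (t.le 0) k ≤ mu (t.le 0) (k + 1) := by
  intro X hX
  rw [mu_iff hA] at hX ⊢
  exact (t.le 0).prop_of_iso ((stalkShiftIso k 1 (k + 1) rfl).app X) (le_shift_one hX)

theorem isCoreflective_mu (hA : ExtTwoVanishes A) (k : ℤ) : IsCoreflective (mu (t.le 0) k) := by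
  refine isCoreflective_of_forall fun Y => ?_
  obtain ⟨U, V, hU, hV, f, g, h, hT⟩ := t.exists_triangle_zero_one ((stalk A k).obj Y)
  replace hT : IsTri f g h := hT
  -- The coreflection of `Y` is the degree `k` homology of the aisle part `U` of `Y[k]`. Being a
  -- summand, `M[k]` is again in the aisle.
  obtain ⟨M, s, r, hsr, hs⟩ := exists_stalk_summand hA U k
  obtain ⟨e, he⟩ := (stalk A k).map_surjective (s ≫ f)
  have : Mono s := mono_of_mono_fac hsr
  refine ⟨M, e, (mu_iff hA k M).2 (le_of_retract s r hsr hU), fun Z hZ z => ?_, fun Z hZ z hz => ?_⟩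
  · rw [mu_iff hA] at hZ
    obtain ⟨ζ, hζ⟩ := hT.coyoneda₂ ((stalk A k).map z) (t.zero' _ hZ hV)
    have : (stalk A k ⋙ homology A k).Full := Functor.Full.of_iso (stalkHomologyIso A k).symm
    have : (stalk A k ⋙ homology A k).Faithful := Functor.Faithful.of_iso (stalkHomologyIso A k).symm
    obtain ⟨a, ha⟩ := (stalk A k ⋙ homology A k).map_surjective
      ((homology A k).map ζ ≫ inv ((homology A k).map s))
    refine ⟨a, (stalk A k ⋙ homology A k).map_injective ?_⟩
    rw [Functor.map_comp, ha, Functor.comp_map, Functor.comp_map, he, hζ]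
    simp
  · rw [mu_iff hA] at hZ
    have h₀ : ((stalk A k).map z ≫ s) ≫ f = 0 := by
      rw [Category.assoc, ← he, ← Functor.map_comp, hz, Functor.map_zero]
    -- The shift of a map killed by `f` factors through `V`, and `Z[k + 1]` has no nonzero maps to
    -- `V`.
    obtain ⟨ψ, hψ⟩ := hT.rot.rot.coyoneda₂ (((stalk A k).map z ≫ s)⟦(1 : ℤ)⟧') (by
      rw [Preadditive.comp_neg, ← Functor.map_comp, h₀, Functor.map_zero, neg_zero])
    rw [t.zero' ψ (le_shift_one hZ) hV, zero_comp] at hψ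
    have h₁ := (shiftFunctor (Bounded A) (1 : ℤ)).map_injective
      (hψ.trans (Functor.map_zero _ _ _).symm)
    exact (stalk A k).map_injective (by
      rw [← cancel_mono s, h₁, Functor.map_zero, zero_comp])

theorem isCoreflectiveNarrowSequence_mu (hA : ExtTwoVanishes A) :
    IsCoreflectiveNarrowSequence (mu (t.le 0)) where
  isNarrow k :=
    { exists_zero := ⟨_, isZero_zero A, by
        rw [mu_iff hA]
        have : t.IsLE ((stalk A k).obj 0) 0 := by
          rw [t.isLE_iff_orthogonal 0 1 rfl]
          exact fun _ _ _ => ((stalk A k).map_isZero (isZero_zero A)).eq_of_src _ _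
        exact this.le⟩
      cokernels_le := by
        rintro _ ⟨f, c, hc, hf⟩
        exact (mu (t.le 0) k).prop_of_iso ((colimit.isColimit _).coconePointUniqueUpToIso hc)
          (mu_cokernel hA f (mu_le_succ hA k _ hf.1) hf.2)
      prop_X₂_of_shortExact := mu_extension hA }
  le_succ := mu_le_succ hA
  of_exact k X₀ X₁ X₂ X₃ X₄ f g h i H h₀ h₁ h₃ h₄ := by
    obtain ⟨a, b, w, hS⟩ := exists_shortExact_of_exact H
    exact mu_extension hA hS (mu_cokernel hA f h₀ h₁) (mu_kernel hA i h₃ h₄)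
  isCoreflective := isCoreflective_mu hA

/-- Shifting recovers every `le n` from `le 0`, and each `ge n` is the orthogonal of `le (n - 1)`.
-/
theorem tStructure_ext {t t' : TStructure (Bounded A)} (h : t.le 0 = t'.le 0) : t = t' := by
  have h₁ : t.le = t'.le := by
    funext n
    rw [← t.shift_le n 0 n (by lia), ← t'.shift_le n 0 n (by lia), h]
  have h₂ : t.ge = t'.ge := by
    funext n
    ext X
    rw [TStructure.ge_iff_isGE, TStructure.ge_iff_isGE, t.isGE_iff_orthogonal (n - 1) n (by lia),
      t'.isGE_iff_orthogonal (n - 1) n (by lia)]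
    refine forall₂_congr fun Y f => ?_
    rw [← TStructure.le_iff_isLE, ← TStructure.le_iff_isLE, h₁]
  cases t
  cases t'
  cases h₁
  cases h₂
  rfl

end Aisle

/-! ### Triangles of stalk complexes and short exact sequences. -/

section StalkTriangles

open DerivedCategory Pretriangulated ZeroObject

variable {A : Type u} [Category.{v} A] [Abelian A] [HasDerivedCategory.{w} A]

theorem shortExact_of_isTri_stalk {k : ℤ} {X Y Z : A} {i : X ⟶ Y} {p : Y ⟶ Z}
    {δ : (stalk A k).obj Z ⟶ ((stalk A k).obj X)⟦(1 : ℤ)⟧}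
    (hT : IsTri ((stalk A k).map i) ((stalk A k).map p) δ) :
    ∃ w : i ≫ p = 0, (ShortComplex.mk i p w).ShortExact := by
  have iso {X Y : A} (f : X ⟶ Y) := ((Functor.mapArrowFunctor _ _).mapIso
    (stalkHomologyIso A k)).app (Arrow.mk f)
  have w : i ≫ p = 0 := (stalk A k).map_injective (by
    rw [Functor.map_comp, hT.zero₁₂, Functor.map_zero])
  have hm : Mono i := ((MorphismProperty.monomorphisms A).arrow_mk_iso_iff (iso i)).1
    ((hT.exact₁ (k + 1) k rfl).mono_g ((isZero_homology_stalk Z (by lia)).eq_of_src _ _))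
  have he : Epi p := ((MorphismProperty.epimorphisms A).arrow_mk_iso_iff (iso p)).1
    ((hT.exact₃ k (k - 1) (by lia)).epi_f ((isZero_homology_stalk X (by lia)).eq_of_tgt _ _))
  refine ⟨w, { exact := ShortComplex.exact_of_iso (ShortComplex.isoMk
    ((stalkHomologyIso A k).app X) ((stalkHomologyIso A k).app Y)
    ((stalkHomologyIso A k).app Z) ?_ ?_) (hT.exact₂ k) }⟩
  · exact ((stalkHomologyIso A k).hom.naturality i).symm
  · exact ((stalkHomologyIso A k).hom.naturality p).symm

theorem exists_isTri_stalk_of_hom {k : ℤ} {X Z : A}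
    (δ : (stalk A k).obj Z ⟶ ((stalk A k).obj X)⟦(1 : ℤ)⟧) :
    ∃ (Y : A) (i : X ⟶ Y) (p : Y ⟶ Z), IsTri ((stalk A k).map i) ((stalk A k).map p) δ := by
  obtain ⟨Y, f, g, hT⟩ := IsTri.exists_of_mor₃ δ
  obtain ⟨Y', ⟨e⟩⟩ := exists_iso_stalk Y k fun j hj =>
    hT.isZero_homology₂ j (isZero_homology_stalk X hj) (isZero_homology_stalk Z hj)
  obtain ⟨i, hi⟩ := (stalk A k).map_surjective (f ≫ e.hom)
  obtain ⟨p, hp⟩ := (stalk A k).map_surjective (e.inv ≫ g)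
  exact ⟨Y', i, p, hT.of_iso (Iso.refl _) e (Iso.refl _) (by simp [hi]) (by simp [hp]) (by simp)⟩

/-- In a general triangle the first two maps do not determine the third. Here the comparison map on
the third term is the identity because `p` is an epimorphism in `A`. -/
theorem isTri_stalk_unique {k : ℤ} {X Y Z : A} {i : X ⟶ Y} {p : Y ⟶ Z}
    {δ δ' : (stalk A k).obj Z ⟶ ((stalk A k).obj X)⟦(1 : ℤ)⟧}
    (hT : IsTri ((stalk A k).map i) ((stalk A k).map p) δ)
    (hT' : IsTri ((stalk A k).map i) ((stalk A k).map p) δ') : δ = δ' := by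
  obtain ⟨c, hc, hc'⟩ := hT.complete₃ hT' (𝟙 _) (𝟙 _) (by simp)
  obtain ⟨c, rfl⟩ := (stalk A k).map_surjective c
  obtain ⟨_, hS⟩ := shortExact_of_isTri_stalk hT
  have : Epi p := hS.epi_g
  have h : c = 𝟙 _ := by
    rw [← cancel_epi p]
    exact (stalk A k).map_injective (by simpa using hc)
  simpa [h] using hc'

end StalkTriangles

/-! ### Heredity of wide subcategories. -/

section Wide

open DerivedCategory Pretriangulated ZeroObject

variable {A : Type u} [Category.{v} A] [Abelian A] (W : ObjectProperty A) [IsWide W]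

theorem shortExact_fullSubcategory {S : ShortComplex W.FullSubcategory}
    (hS : (S.map W.ι).ShortExact) : S.ShortExact where
  exact := (ShortComplex.exact_map_iff_of_faithful S W.ι).1 hS.exact
  mono_f := W.ι.mono_of_mono_map hS.mono_f
  epi_g := W.ι.epi_of_epi_map hS.epi_g

variable [HasDerivedCategory.{w} A] [HasDerivedCategory.{w'} W.FullSubcategory]

/-- Wide subcategories of hereditary categories are hereditary. -/
theorem extTwoVanishes_fullSubcategory (hA : ExtTwoVanishes A) :
    ExtTwoVanishes W.FullSubcategory := by
  intro M N α
  obtain ⟨E, p, hp, h⟩ := exists_epi_comp_eq_zero (by lia) α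
  have hS : (ShortComplex.mk (kernel.ι p) p (kernel.condition p)).ShortExact :=
    { exact := ShortComplex.exact_kernel p }
  obtain ⟨β, rfl⟩ := hS.isTri.yoneda₃ α h
  let e := (shiftFunctorAdd' (DerivedCategory W.FullSubcategory) (1 : ℤ) 1 2 (by lia)).app
    ((singleFunctor W.FullSubcategory 0).obj N)
  obtain ⟨γ, hγ⟩ := (shiftFunctor (DerivedCategory W.FullSubcategory) (1 : ℤ)).map_surjective
    (β ≫ e.hom)
  obtain ⟨Q, i, q, w, hQ, rfl⟩ := exists_shortExact_singleδ_eq γ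
  have hm : Mono (W.ι.map (kernel.ι p)) := W.ι.map_mono (kernel.ι p)
  -- The class `α` is the connecting map followed by the shift of the class of an extension `Q` of
  -- `kernel p` by `N`. In `A` this extension extends over `E`, and its new middle term stays in
  -- `W`. So the class factors through `kernel p → E`, whose shift is killed by the connecting map.
  obtain ⟨P, i', p', w', b, hP, h₁, h₂⟩ := @exists_extension_of_mono _ _ _ _ hA _
    (hQ.map_of_exact W.ι) _ (W.ι.map (kernel.ι p)) hm
  have hPW : W P := W.prop_X₂_of_shortExact hP N.property E.property
  let P₀ : W.FullSubcategory := ⟨P, hPW⟩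
  obtain ⟨i₀, hi₀⟩ := W.ι.map_surjective (X := N) (Y := P₀) i'
  obtain ⟨p₀, hp₀⟩ := W.ι.map_surjective (X := P₀) (Y := E) p'
  obtain ⟨b₀, hb₀⟩ := W.ι.map_surjective (X := Q) (Y := P₀) b
  subst hi₀ hp₀ hb₀
  have hP₀ : (ShortComplex.mk i₀ p₀ (W.ι.map_injective w')).ShortExact :=
    shortExact_fullSubcategory W hP
  have h₁' : i ≫ b₀ = i₀ := W.ι.map_injective h₁
  have h₂' : b₀ ≫ p₀ = q ≫ kernel.ι p := W.ι.map_injective h₂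
  obtain ⟨c, hc, hc'⟩ := hQ.isTri.complete₃ hP₀.isTri (𝟙 _) ((singleFunctor _ 0).map b₀) (by
    rw [← Functor.map_comp, h₁', Category.id_comp])
  obtain ⟨c, rfl⟩ := (singleFunctor W.FullSubcategory 0).map_surjective c
  have : Epi q := hQ.epi_g
  have h₃ : c = kernel.ι p := by
    rw [← cancel_epi q]
    exact (singleFunctor W.FullSubcategory 0).map_injective (by
      rw [Functor.map_comp, hc, ← Functor.map_comp, h₂'])
  subst h₃
  rw [CategoryTheory.Functor.map_id, Category.comp_id] at hc'
  rw [hc', Functor.map_comp] at hγ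
  rw [← cancel_mono e.hom, Category.assoc, ← hγ, ← Category.assoc]
  have := hS.isTri.zero₃₁
  dsimp at this ⊢
  rw [this, zero_comp, zero_comp]

end Wide

/-! ### The functor on bounded derived categories induced by an exact functor. -/

section MapBounded

open DerivedCategory Pretriangulated ZeroObject

variable {A : Type u} [Category.{v} A] [Abelian A] [HasDerivedCategory.{w} A]
  {B : Type u'} [Category.{v'} B] [Abelian B] [HasDerivedCategory.{w'} B]
  (F : B ⥤ A) [F.Additive] [PreservesFiniteLimits F] [PreservesFiniteColimits F]

instance : (mapBounded F).CommShift ℤ :=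
  inferInstanceAs (Functor.CommShift (ObjectProperty.lift _
    (DerivedCategory.Bounded.ι ⋙ F.mapDerivedCategory) (bounded_mapDerivedCategory_obj F)) ℤ)

instance : (mapBounded F).IsTriangulated :=
  inferInstanceAs (Functor.IsTriangulated (ObjectProperty.lift _
    (DerivedCategory.Bounded.ι ⋙ F.mapDerivedCategory) (bounded_mapDerivedCategory_obj F)))

def singleMapIso : single B ⋙ mapBounded F ≅ F ⋙ single A :=
  NatIso.ofComponents
    (fun M => ObjectProperty.isoMk _ ((F.mapDerivedCategorySingleFunctor 0).app M))
    (fun f => Bounded.ι.map_injective ((F.mapDerivedCategorySingleFunctor 0).hom.naturality f))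

/-- Stalk complexes are preserved by exact functors. -/
def stalkMapIso (k : ℤ) : stalk B k ⋙ mapBounded F ≅ F ⋙ stalk A k :=
  Functor.isoWhiskerLeft (single B) ((mapBounded F).commShiftIso k) ≪≫
    Functor.isoWhiskerRight (singleMapIso F) (shiftFunctor _ k)

theorem IsTri.map {X Y Z : Bounded B} {f : X ⟶ Y} {g : Y ⟶ Z} {h : Z ⟶ X⟦(1 : ℤ)⟧}
    (hT : IsTri f g h) : IsTri ((mapBounded F).map f) ((mapBounded F).map g)
      ((mapBounded F).map h ≫ ((mapBounded F).commShiftIso (1 : ℤ)).hom.app X) :=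
  (mapBounded F).map_distinguished _ hT

end MapBounded

/-! ### The functor `D^b W ⥤ D^b A` for a wide subcategory. -/

section Wide

open DerivedCategory Pretriangulated ZeroObject

variable {A : Type u} [Category.{v} A] [Abelian A] (W : ObjectProperty A) [IsWide W]
variable [HasDerivedCategory.{w} A] [HasDerivedCategory.{w'} W.FullSubcategory]

theorem homology_mapBounded (L : Bounded W.FullSubcategory) (k : ℤ) :
    W ((homology A k).obj ((mapBounded W.ι).obj L)) := by
  have := isClosedUnderIsomorphisms_of_isWide W
  have hz {X : A} (hX : IsZero X) : W X := W.prop_of_isZero hX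
  revert k
  refine devissage (fun L => ∀ k, W ((homology A k).obj ((mapBounded W.ι).obj L))) L ?_ ?_ ?_
  · exact fun Y hY k => hz (Functor.map_isZero _ (Functor.map_isZero _ hY))
  · rintro n Y hY - k
    obtain ⟨M, ⟨e⟩⟩ := exists_iso_stalk Y n hY
    let e' : (mapBounded W.ι).obj Y ≅ (stalk A n).obj (W.ι.obj M) :=
      (mapBounded W.ι).mapIso e ≪≫ (stalkMapIso W.ι n).app M
    refine W.prop_of_iso ((homology A k).mapIso e'.symm) ?_
    by_cases hk : k = n
    · subst hk
      exact W.prop_of_iso ((stalkHomologyIso A k).symm.app (W.ι.obj M)) M.property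
    · exact hz (isZero_homology_stalk _ hk)
  · intro n X₁ X₂ X₃ f g h hT _ _ h₁ h₃ k
    exact prop_of_exact_of_isWide W ((hT.map W.ι).exact_homology₂ (k + 1) k (k - 1) rfl (by lia))
      (h₃ _) (h₁ _) (h₃ _) (h₁ _)

/-- Only `Hom` (`i = j`) and `Ext^1` (`i = j + 1`) can be nonzero. The first is unchanged since `W`
is full, the second lifts since an extension in `A` of objects of `W` has its middle term in `W`. -/
theorem mapBounded_map_surjective_stalk (hA : ExtTwoVanishes A) (i j : ℤ) (Z M : W.FullSubcategory)
    (g : (mapBounded W.ι).obj ((stalk W.FullSubcategory j).obj Z) ⟶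
      (mapBounded W.ι).obj ((stalk W.FullSubcategory i).obj M)) :
    ∃ g', (mapBounded W.ι).map g' = g := by
  let eZ := (stalkMapIso W.ι j).app Z
  let eM := (stalkMapIso W.ι i).app M
  by_cases h : i < j ∨ j + 2 ≤ i
  · have h₀ : eZ.inv ≫ g ≫ eM.hom = 0 := by
      rcases h with h | h
      · exact hom_eq_zero_of_lt j (fun k hk => isZero_homology_stalk _ (by lia))
          (fun k hk => isZero_homology_stalk _ (by lia)) _
      · exact hom_stalk_eq_zero hA h _
    refine ⟨0, ?_⟩
    rw [Functor.map_zero, ← cancel_epi eZ.inv, ← cancel_mono eM.hom, Category.assoc, Category.assoc, h₀,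
      zero_comp, comp_zero]
  obtain rfl | rfl : i = j ∨ i = j + 1 := by lia
  · obtain ⟨f, hf⟩ := (stalk A i).map_surjective (eZ.inv ≫ g ≫ eM.hom)
    obtain ⟨f, rfl⟩ := W.ι.map_surjective f
    refine ⟨(stalk _ i).map f, ?_⟩
    have := (stalkMapIso W.ι i).hom.naturality f
    rw [← cancel_mono eM.hom]
    refine this.trans ?_
    exact (congrArg (eZ.hom ≫ ·) hf).trans (by simp)
  · let e := (stalkShiftIso (A := W.FullSubcategory) j 1 (j + 1) rfl).app M
    let c := ((mapBounded W.ι).commShiftIso (1 : ℤ)).app ((stalk W.FullSubcategory j).obj M)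
    let eM' := (stalkMapIso W.ι j).app M
    let δ : (stalk A j).obj (W.ι.obj Z) ⟶ ((stalk A j).obj (W.ι.obj M))⟦(1 : ℤ)⟧ :=
      eZ.inv ≫ g ≫ (mapBounded W.ι).map e.inv ≫ c.hom ≫ eM'.hom⟦(1 : ℤ)⟧'
    obtain ⟨Y, a, p, hT⟩ := exists_isTri_stalk_of_hom δ
    obtain ⟨w, hS⟩ := shortExact_of_isTri_stalk hT
    obtain ⟨Y₀, rfl⟩ : ∃ Y₀ : W.FullSubcategory, W.ι.obj Y₀ = Y :=
      ⟨⟨Y, W.prop_X₂_of_shortExact hS M.property Z.property⟩, rfl⟩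
    obtain ⟨a₀, rfl⟩ := W.ι.map_surjective (X := M) (Y := Y₀) a
    obtain ⟨p₀, rfl⟩ := W.ι.map_surjective (X := Y₀) (Y := Z) p
    have hS₀ : (ShortComplex.mk a₀ p₀ (W.ι.map_injective w)).ShortExact :=
      shortExact_fullSubcategory W hS
    obtain ⟨δ₀, hT₀⟩ := hS₀.exists_isTri_stalk j
    have hT₁ : IsTri ((stalk A j).map (W.ι.map a₀)) ((stalk A j).map (W.ι.map p₀))
        (eZ.inv ≫ (mapBounded W.ι).map δ₀ ≫ c.hom ≫ eM'.hom⟦(1 : ℤ)⟧') :=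
      (hT₀.map W.ι).of_iso eM' ((stalkMapIso W.ι j).app Y₀) eZ
        ((stalkMapIso W.ι j).hom.naturality a₀) ((stalkMapIso W.ι j).hom.naturality p₀)
        ((Category.assoc _ _ _).trans (eZ.hom_inv_id_assoc _).symm)
    refine ⟨δ₀ ≫ e.hom, ?_⟩
    have h₁ := isTri_stalk_unique hT₁ hT
    have h₂ : (mapBounded W.ι).map δ₀ = g ≫ (mapBounded W.ι).map e.inv := by
      rw [← cancel_epi eZ.inv, ← cancel_mono (c.hom ≫ eM'.hom⟦(1 : ℤ)⟧')]
      simpa [δ] using h₁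
    rw [Functor.map_comp, h₂, Category.assoc, ← Functor.map_comp, e.inv_hom_id,
      CategoryTheory.Functor.map_id, Category.comp_id]

theorem mapBounded_map_surjective (hA : ExtTwoVanishes A) (j : ℤ) (Z : W.FullSubcategory)
    (L : Bounded W.FullSubcategory)
    (g : (mapBounded W.ι).obj ((stalk W.FullSubcategory j).obj Z) ⟶ (mapBounded W.ι).obj L) :
    ∃ g', (mapBounded W.ι).map g' = g := by
  revert g
  refine devissage_split (extTwoVanishes_fullSubcategory W hA) (fun L => ∀ g : (mapBounded W.ι).obj
    ((stalk W.FullSubcategory j).obj Z) ⟶ (mapBounded W.ι).obj L,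
    ∃ g', (mapBounded W.ι).map g' = g) L ?_ ?_ ?_
  · exact fun Y hY g => ⟨0, ((mapBounded W.ι).map_isZero hY).eq_of_tgt _ _⟩
  · rintro i Y hY - g
    obtain ⟨M, ⟨e⟩⟩ := exists_iso_stalk Y i hY
    obtain ⟨g', hg'⟩ := mapBounded_map_surjective_stalk W hA i j Z M (g ≫ (mapBounded W.ι).map e.hom)
    refine ⟨g' ≫ e.inv, ?_⟩
    rw [Functor.map_comp, hg', Category.assoc, ← Functor.map_comp, e.hom_inv_id,
      CategoryTheory.Functor.map_id, Category.comp_id]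
  · intro X₁ X₂ X₃ f g hT h₁ h₃ φ
    obtain ⟨r, s, -, -, hrs, -⟩ := hT.split rfl
    obtain ⟨a, ha⟩ := h₁ (φ ≫ (mapBounded W.ι).map r)
    obtain ⟨b, hb⟩ := h₃ (φ ≫ (mapBounded W.ι).map g)
    refine ⟨a ≫ f + b ≫ s, ?_⟩
    rw [Functor.map_add, Functor.map_comp, Functor.map_comp, ha, hb, Category.assoc,
      Category.assoc, ← Functor.map_comp, ← Functor.map_comp, ← Preadditive.comp_add,
      ← Functor.map_add, hrs, CategoryTheory.Functor.map_id, Category.comp_id]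

omit [HasDerivedCategory.{w'} W.FullSubcategory] in
/-- The triangle of the coreflection into `D^b W`. -/
theorem exists_isTri_of_hasDerivedRightAdjoint (hA : ExtTwoVanishes A)
    (hW : HasDerivedRightAdjoint A W) (Y : Bounded A) :
    ∃ (S V : Bounded A) (f : S ⟶ Y) (g : Y ⟶ V) (h : V ⟶ S⟦(1 : ℤ)⟧), IsTri f g h ∧
      (∀ k, W ((homology A k).obj S)) ∧
      ∀ (k : ℤ) (Z : A), W Z → ∀ φ : (stalk A k).obj Z ⟶ V, φ = 0 := by
  let := HasDerivedCategory.standard W.FullSubcategory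
  have : (mapBounded (A := A) W.ι).IsLeftAdjoint := hW
  let adj := Adjunction.ofIsLeftAdjoint (mapBounded (A := A) W.ι)
  obtain ⟨V, g, h, hT⟩ := IsTri.exists_of_mor₁ (adj.counit.app Y)
  refine ⟨_, V, _, g, h, hT, homology_mapBounded W _, fun k Z hZ φ => ?_⟩
  -- Composition with the counit is injective on maps from `Z[k]`: by fullness such a map comes from
  -- `D^b W`, where the adjunction applies. Faithfulness is not needed.
  have inj (k : ℤ) (ψ : (stalk A k).obj Z ⟶
      (mapBounded W.ι).obj ((mapBounded (A := A) W.ι).rightAdjoint.obj Y))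
      (hψ : ψ ≫ adj.counit.app Y = 0) : ψ = 0 := by
    let e := (stalkMapIso (A := A) W.ι k).app ⟨Z, hZ⟩
    obtain ⟨a, ha⟩ := mapBounded_map_surjective W hA k ⟨Z, hZ⟩ _ (e.hom ≫ ψ)
    have h₀ : a = 0 := (adj.homEquiv _ _).symm.injective (by
      rw [Adjunction.homEquiv_counit, Adjunction.homEquiv_counit, ha, Category.assoc]
      exact (congrArg (e.hom ≫ ·) hψ).trans (by simp))
    rw [h₀, Functor.map_zero] at ha
    rw [← cancel_epi e.hom, ← ha, comp_zero]
  have h₁ : φ ≫ h = 0 := by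
    let e := (stalkShiftIso (A := A) (k - 1) 1 k (by lia)).app Z
    obtain ⟨ψ, hψ⟩ := (shiftFunctor (Bounded A) (1 : ℤ)).map_surjective (e.hom ≫ φ ≫ h)
    have : ψ = 0 := inj (k - 1) ψ ((shiftFunctor (Bounded A) (1 : ℤ)).map_injective (by
      rw [Functor.map_comp, hψ, Category.assoc, Category.assoc, hT.zero₃₁]
      simp))
    rw [← cancel_epi e.hom, ← hψ, this, Functor.map_zero, comp_zero]
  obtain ⟨ψ, rfl⟩ := hT.coyoneda₃ φ h₁
  let e := (stalkMapIso (A := A) W.ι k).app ⟨Z, hZ⟩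
  have h₂ : e.hom ≫ ψ = (mapBounded W.ι).map ((adj.homEquiv _ _) (e.hom ≫ ψ)) ≫
      adj.counit.app Y :=
    ((adj.homEquiv _ _).symm_apply_apply (e.hom ≫ ψ)).symm.trans
      (adj.homEquiv_counit _ _ _)
  rw [← cancel_epi e.hom, ← Category.assoc, h₂, Category.assoc, hT.zero₁₂, comp_zero, comp_zero]

end Wide

/-! ### Narrow sequences, wide closures and coreflections. -/

section NarrowSequence

open ZeroObject

variable {A : Type u} [Category.{v} A] [Abelian A]

theorem wideClosure_mono {P Q : ObjectProperty A} (h : P ≤ Q) : wideClosure P ≤ wideClosure Q :=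
  fun _ hX W hW hQ => hX W hW (h.trans hQ)

theorem exists_shortExact_pullback {S : ShortComplex A} (hS : S.ShortExact) {Z : A}
    (z : Z ⟶ S.X₃) : ∃ (P : A) (i : S.X₁ ⟶ P) (p : P ⟶ Z) (w : i ≫ p = 0) (b : P ⟶ S.X₂),
      (ShortComplex.mk i p w).ShortExact ∧ b ≫ S.g = p ≫ z := by
  have := hS.mono_f
  have := hS.epi_g
  let i : S.X₁ ⟶ pullback S.g z := pullback.lift S.f 0 (by simp)
  have hi : i ≫ pullback.fst S.g z = S.f := pullback.lift_fst _ _ _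
  have w : i ≫ pullback.snd S.g z = 0 := pullback.lift_snd _ _ _
  have hm : Mono i := mono_of_mono_fac hi
  have he : Epi (pullback.snd S.g z) := inferInstance
  refine ⟨_, i, pullback.snd S.g z, w, pullback.fst S.g z, { exact := ?_ }, pullback.condition⟩
  rw [ShortComplex.exact_iff_exact_up_to_refinements]
  intro T x hx
  dsimp at x hx
  refine ⟨T, 𝟙 T, inferInstance, hS.exact.lift (x ≫ pullback.fst S.g z) ?_, ?_⟩
  · rw [Category.assoc, pullback.condition, reassoc_of% hx, zero_comp]
  · dsimp
    rw [Category.id_comp]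
    apply pullback.hom_ext
    · rw [Category.assoc, hi, hS.exact.lift_f]
    · rw [Category.assoc, w, comp_zero]
      exact hx

omit [Abelian A] in
theorem IsCoreflective.exists_hom {P : ObjectProperty A} (hP : IsCoreflective P) (Y : A) :
    ∃ (X : A) (e : X ⟶ Y), P X ∧
      (∀ (Z : A) (_ : P Z) (f : Z ⟶ Y), ∃ g : Z ⟶ X, g ≫ e = f) ∧
      (∀ (Z : A) (_ : P Z) (g g' : Z ⟶ X), g ≫ e = g' ≫ e → g = g') := by
  have : P.ι.IsLeftAdjoint := hP
  let adj := Adjunction.ofIsLeftAdjoint P.ι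
  refine ⟨_, adj.counit.app Y, (P.ι.rightAdjoint.obj Y).property, fun Z hZ f => ?_,
    fun Z hZ g g' h => ?_⟩
  · let f' : P.ι.obj ⟨Z, hZ⟩ ⟶ Y := f
    exact ⟨P.ι.map (adj.homEquiv _ _ f'),
      ((adj.homEquiv_counit _ _ _).symm.trans ((adj.homEquiv _ _).symm_apply_apply f'))⟩
  · let a : (⟨Z, hZ⟩ : P.FullSubcategory) ⟶ P.ι.rightAdjoint.obj Y := ObjectProperty.homMk g
    let a' : (⟨Z, hZ⟩ : P.FullSubcategory) ⟶ P.ι.rightAdjoint.obj Y := ObjectProperty.homMk g'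
    have : a = a' := (adj.homEquiv _ _).symm.injective
      ((adj.homEquiv_counit _ _ a).trans (h.trans (adj.homEquiv_counit _ _ a').symm))
    exact congrArg P.ι.map this

variable {N : ℤ → ObjectProperty A} (hN : IsNarrowSequence N)

include hN

theorem IsNarrowSequence.isClosedUnderIsomorphisms (k : ℤ) :
    (N k).IsClosedUnderIsomorphisms :=
  have := hN.isNarrow k
  isClosedUnderIsomorphisms_of_isNarrow (N k)

theorem IsNarrowSequence.prop_of_isZero {X : A} (hX : IsZero X) (k : ℤ) : N k X := by
  have := hN.isNarrow k
  have := hN.isClosedUnderIsomorphisms k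
  exact (N k).prop_of_isZero hX

theorem IsNarrowSequence.mono {i j : ℤ} (h : i ≤ j) : N i ≤ N j := by
  induction j, h using Int.leInduction with
  | base => exact le_rfl
  | succ j _ ih => exact ih.trans (hN.le_succ j)

variable [HasDerivedCategory.{w} A]

/-- An object of the wide closure is a kernel of a map from `N k` to `N k`; the five-term condition
at `k + 1` requires its target only in `N k`. -/
theorem IsNarrowSequence.wideClosure_le (hA : ExtTwoVanishes A) (k : ℤ) :
    wideClosure (N k) ≤ N (k + 1) := by
  have := hN.isNarrow k
  rw [wideClosure_eq_kernelClosure hA]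
  rintro X ⟨E, i, hi, h₁, h₂⟩
  have h₀ (j : ℤ) : N j 0 := hN.prop_of_isZero (isZero_zero A) j
  refine hN.of_exact (k + 1) (0 : (0 : A) ⟶ 0) (0 : 0 ⟶ X) i (cokernel.π i) (exact_mk₄
    (w₁ := zero_comp) (w₂ := zero_comp) (w₃ := cokernel.condition i)
    (ShortComplex.exact_of_isZero_X₂ _ (isZero_zero A)) ?_ (ShortComplex.exact_cokernel i))
    (h₀ _) (h₀ _) (hN.le_succ k _ h₁) (by simpa using h₂)
  exact (ShortComplex.exact_iff_mono _ rfl).2 hi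

omit hN in
/-- The coreflection into a narrow subcategory of an object in its wide closure. -/
theorem exists_shortExact_coreflection (hA : ExtTwoVanishes A) (P : ObjectProperty A) [IsNarrow P]
    (hP : IsCoreflective P) {Y : A} (hY : wideClosure P Y) :
    ∃ (C Q : A) (c : C ⟶ Y) (q : Y ⟶ Q) (w : c ≫ q = 0), (ShortComplex.mk c q w).ShortExact ∧
      P C ∧ ∀ (Z : A), P Z → ∀ z : Z ⟶ Q, z = 0 := by
  obtain ⟨C, c, hC, h₁, h₂⟩ := hP.exists_hom Y
  -- The image of the counit is in the wide closure and is a quotient of `C`, hence in `P`. Its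
  -- inclusion therefore factors through `c`, which forces `c` to be mono.
  have hI : wideClosure P (Abelian.image c) := (wideClosure P).prop_kernel _ hY
    ((wideClosure P).prop_cokernel c (le_wideClosure P _ hC) hY)
  have hI' : P (Abelian.image c) :=
    prop_of_epi_of_wideClosure hA P (Abelian.factorThruImage c) hC hI
  obtain ⟨l, hl⟩ := h₁ _ hI' (Abelian.image.ι c)
  have hm : Mono (Abelian.factorThruImage c) := mono_of_mono_fac
    (h₂ C hC (Abelian.factorThruImage c ≫ l) (𝟙 C) (by simp [hl]))
  have hc : Mono c := by
    rw [← Abelian.image.fac c]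
    infer_instance
  have hS : (ShortComplex.mk c (cokernel.π c) (cokernel.condition c)).ShortExact :=
    { exact := ShortComplex.exact_cokernel c }
  refine ⟨C, _, c, cokernel.π c, cokernel.condition c, hS, hC, fun Z hZ z => ?_⟩
  -- The pullback of `Y → Q` along `z` extends `Z` by `C`, so lies in `P`. Its map to `Y` factors
  -- through `C` and dies in `Q`.
  obtain ⟨E, i, p, w, b, hE, hb⟩ := exists_shortExact_pullback hS z
  obtain ⟨g, hg⟩ := h₁ E (P.prop_X₂_of_shortExact hE hC hZ) b
  have : Epi p := hE.epi_g
  dsimp at hb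
  rw [← cancel_epi p, ← hb, ← hg, Category.assoc, cokernel.condition, comp_zero, comp_zero]

end NarrowSequence

/-! ### Approximation relative to a single narrow subcategory. -/

section Approximation

open DerivedCategory Pretriangulated ZeroObject

variable {A : Type u} [Category.{v} A] [Abelian A] [HasDerivedCategory.{w} A]

/-- Approximation of bounded complexes by those with homology in `wide P`, in degrees at
least `k`, and with `k`-th homology in `P`. -/
theorem exists_isTri_of_isNarrow (hA : ExtTwoVanishes A) (P : ObjectProperty A) [IsNarrow P]
    (hP : IsCoreflective P) (hW : HasDerivedRightAdjoint A (wideClosure P)) (k : ℤ)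
    (Y : Bounded A) :
    ∃ (U V : Bounded A) (f : U ⟶ Y) (g : Y ⟶ V) (h : V ⟶ U⟦(1 : ℤ)⟧), IsTri f g h ∧
      (∀ j, wideClosure P ((homology A j).obj U)) ∧
      (∀ j < k, IsZero ((homology A j).obj U)) ∧ P ((homology A k).obj U) ∧
      (∀ j, k < j → ∀ Z, wideClosure P Z → ∀ φ : (stalk A j).obj Z ⟶ V, φ = 0) ∧
      (∀ Z, P Z → ∀ φ : (stalk A k).obj Z ⟶ V, φ = 0) := by
  have isoP := isClosedUnderIsomorphisms_of_isNarrow P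
  have isoW := isClosedUnderIsomorphisms_of_isWide (wideClosure P)
  have hz {X : A} (hX : IsZero X) : wideClosure P X := (wideClosure P).prop_of_isZero hX
  obtain ⟨S, V', f, g, h, hT, hS, hV'⟩ :=
    exists_isTri_of_hasDerivedRightAdjoint (wideClosure P) hA hW Y
  obtain ⟨X₁, X₂, f₁, g₁, h₁, hT₁, a₁, b₁, c₁, d₁⟩ := exists_truncation S k
  have hX₁ (j : ℤ) : wideClosure P ((homology A j).obj X₁) := by
    by_cases hj : j < k
    · exact hz (a₁ j hj)
    · have := c₁ j (by lia)
      exact (wideClosure P).prop_of_iso (asIso ((homology A j).map f₁)).symm (hS j)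
  obtain ⟨X₃, X₄, f₂, g₂, h₂, hT₂, a₂, b₂, c₂, d₂⟩ := exists_truncation X₁ (k + 1)
  have hX₃ (j : ℤ) : wideClosure P ((homology A j).obj X₃) := by
    by_cases hj : j < k + 1
    · exact hz (a₂ j hj)
    · have := c₂ j (by lia)
      exact (wideClosure P).prop_of_iso (asIso ((homology A j).map f₂)).symm (hX₁ j)
  obtain ⟨M, ⟨e⟩⟩ := exists_iso_stalk X₄ k fun j hj => by
    rcases lt_or_gt_of_ne hj with hj | hj
    · have := d₂ j (by lia)
      exact (a₁ j hj).of_iso (asIso ((homology A j).map g₂)).symm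
    · exact b₂ j hj
  have hM : wideClosure P M := by
    have := d₂ k (by lia)
    exact (wideClosure P).prop_of_iso (asIso ((homology A k).map g₂) ≪≫ (homology A k).mapIso e ≪≫
      (stalkHomologyIso A k).app M) (hX₁ k)
  have hT₂' : IsTri f₂ (g₂ ≫ e.hom) (e.inv ≫ h₂) :=
    hT₂.of_iso (Iso.refl _) (Iso.refl _) e (by simp) (by simp) (by simp)
  obtain ⟨C, Q, c, q, w, hE, hC, hQ⟩ := exists_shortExact_coreflection hA P hP hM
  obtain ⟨δ, hδ⟩ := hE.exists_isTri_stalk k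
  -- `U` is the fibre of `X₁ → M[k] → Q[k]`, so its degree `k` homology becomes `C`. The cone `V` of
  -- `U → X₁ → S → Y` is built from `Q[k]`, `X₂` and `V'`, and orthogonality is checked on these
  -- pieces.
  obtain ⟨U, x, d, a, b, y, hx, hab⟩ := hT₂'.comp_fibre hδ
  obtain ⟨V₁, x', d', a', b', y', hx', hab'⟩ := hx.comp hT₁
  obtain ⟨V, x'', d'', a'', b'', y'', hx'', hab''⟩ := hx'.comp hT
  have hst (j : ℤ) : wideClosure P ((homology A j).obj ((stalk A k).obj C)) := by
    by_cases hj : j = k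
    · subst hj
      exact (wideClosure P).prop_of_iso ((stalkHomologyIso A j).symm.app C) (le_wideClosure P _ hC)
    · exact hz (isZero_homology_stalk C hj)
  refine ⟨U, V, _, _, _, hx'', fun j => ?_, fun j hj => ?_, ?_, fun j hj Z hZ φ => ?_,
    fun Z hZ φ => ?_⟩
  · exact prop_of_exact_of_isWide _ (hab.exact_homology₂ (j + 1) j (j - 1) rfl (by lia))
      (hst _) (hX₃ _) (hst _) (hX₃ _)
  · exact hab.isZero_homology₂ j (a₂ j (by lia)) (isZero_homology_stalk C (by lia))
  · have := hab.isIso_homology₂ k (k - 1) (by lia) (a₂ _ (by lia)) (a₂ _ (by lia))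
    exact P.prop_of_iso ((asIso ((homology A k).map b)) ≪≫ (stalkHomologyIso A k).app C).symm hC
  · obtain ⟨ψ, rfl⟩ := hab''.coyoneda₂ φ (hV' j Z hZ _)
    rw [hom_eq_zero_of_lt j (fun i hi => isZero_homology_stalk Z (by lia))
      (fun i hi => hab'.isZero_homology₂ i (isZero_homology_stalk Q (by lia)) (b₁ i (by lia))) ψ,
      zero_comp]
  · obtain ⟨ψ, rfl⟩ := hab''.coyoneda₂ φ (hV' k Z (le_wideClosure P _ hZ) _)
    obtain ⟨χ, rfl⟩ := hab'.coyoneda₂ ψ (hom_eq_zero_of_lt k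
      (fun i hi => isZero_homology_stalk Z (by lia)) b₁ _)
    obtain ⟨z, rfl⟩ := (stalk A k).map_surjective χ
    rw [hQ Z hZ z, Functor.map_zero, zero_comp, zero_comp]

end Approximation

/-! ### Approximation by `θ(N)`. -/

section Theta

open DerivedCategory Pretriangulated ZeroObject

variable {A : Type u} [Category.{v} A] [Abelian A] [HasDerivedCategory.{w} A]
  {N : ℤ → ObjectProperty A} (hN : IsNarrowSequence N)

include hN

theorem IsNarrowSequence.isClosedUnderIsomorphisms_theta : (theta N).IsClosedUnderIsomorphisms where
  of_iso e h k :=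
    have := hN.isClosedUnderIsomorphisms k
    (N k).prop_of_iso ((homology A k).mapIso e) (h k)

theorem IsNarrowSequence.theta_extension {X Y Z : Bounded A} {f : X ⟶ Y} {g : Y ⟶ Z}
    {h : Z ⟶ X⟦(1 : ℤ)⟧} (hT : IsTri f g h) (hX : theta N X) (hZ : theta N Z) : theta N Y :=
  fun k => hN.of_exact k _ _ _ _ (hT.exact_homology₂ (k + 1) k (k - 1) rfl (by lia))
    (hZ _) (hX _) (hZ _) (hX _)

theorem IsNarrowSequence.theta_shift {X : Bounded A} (hX : theta N X) :
    theta N (X⟦(1 : ℤ)⟧) := fun k =>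
  have := hN.isClosedUnderIsomorphisms k
  (N k).prop_of_iso ((homologyShiftIso A 1 k (k - 1) (by lia)).symm.app X)
    (hN.mono (by lia) _ (hX (k - 1)))

theorem IsNarrowSequence.theta_stalk_iff (k : ℤ) (M : A) :
    theta N ((stalk A k).obj M) ↔ N k M := by
  have (j : ℤ) := hN.isClosedUnderIsomorphisms j
  refine ⟨fun h => (N k).prop_of_iso ((stalkHomologyIso A k).app M) (h k), fun h j => ?_⟩
  by_cases hj : j = k
  · subst hj
    exact (N j).prop_of_iso ((stalkHomologyIso A j).symm.app M) h
  · exact hN.prop_of_isZero (isZero_homology_stalk M hj) j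

/-- Orthogonality to `theta N` is tested on stalk complexes. -/
theorem IsNarrowSequence.hom_eq_zero_of_theta {V : Bounded A}
    (hV : ∀ k Z, N k Z → ∀ φ : (stalk A k).obj Z ⟶ V, φ = 0) {Y : Bounded A} (hY : theta N Y)
    (φ : Y ⟶ V) : φ = 0 := by
  revert φ
  refine devissage (fun Y' => ∀ φ : Y' ⟶ V, φ = 0) Y (fun _ h _ => h.eq_of_src _ _) ?_ ?_
  · rintro n Y' hY' ⟨e⟩ φ
    have := hN.isClosedUnderIsomorphisms n
    obtain ⟨e'⟩ := exists_iso_stalk_homology Y' n hY'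
    rw [← cancel_epi e'.inv, hV n _ ((N n).prop_of_iso e.symm (hY n)) (e'.inv ≫ φ), comp_zero]
  · intro _ _ _ _ _ _ _ hT _ _ h₁ h₃ φ
    obtain ⟨ψ, rfl⟩ := hT.yoneda₂ φ (h₁ _)
    rw [h₃ ψ, comp_zero]

variable (hc : ∀ k, IsCoreflective (N k))
  (hW : ∀ k, HasDerivedRightAdjoint A (wideClosure (N k)))

include hc hW

theorem IsNarrowSequence.exists_approximation_of_concentrated (hA : ExtTwoVanishes A) (n : ℤ)
    (X : Bounded A) (hX : ∀ k, k ≠ n → IsZero ((homology A k).obj X)) :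
    ∃ (U V : Bounded A) (f : U ⟶ X) (g : X ⟶ V) (h : V ⟶ U⟦(1 : ℤ)⟧), IsTri f g h ∧
      theta N U ∧ ∀ k Z, N k Z → ∀ φ : (stalk A k).obj Z ⟶ V, φ = 0 := by
  have (k : ℤ) := hN.isNarrow k
  have (k : ℤ) := hN.isClosedUnderIsomorphisms k
  have isoW (k : ℤ) := isClosedUnderIsomorphisms_of_isWide (wideClosure (N k))
  have theta_of (k : ℤ) (U : Bounded A) (h₁ : ∀ j, wideClosure (N k) ((homology A j).obj U))
      (h₂ : ∀ j < k, IsZero ((homology A j).obj U)) (h₃ : N k ((homology A k).obj U)) :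
      theta N U := fun j => by
    rcases lt_trichotomy j k with hj | rfl | hj
    · exact hN.prop_of_isZero (h₂ j hj) j
    · exact h₃
    · exact hN.mono (by lia) _ (hN.wideClosure_le hA k _ (h₁ j))
  -- Two approximations suffice: stalks in degree `n - 1` can map to `X` through `Ext^1`, those in
  -- degree `n` through `Hom`, and those in any other degree not at all.
  obtain ⟨U₁, V₁, f₁, g₁, h₁, hT₁, a₁, b₁, c₁, d₁, e₁⟩ :=
    exists_isTri_of_isNarrow hA (N (n - 1)) (hc _) (hW _) (n - 1) X
  obtain ⟨U₂, V, f₂, g₂, h₂, hT₂, a₂, b₂, c₂, d₂, e₂⟩ :=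
    exists_isTri_of_isNarrow hA (N n) (hc _) (hW _) n V₁
  obtain ⟨U, f, h, a, b, c, hT, hU⟩ := hT₁.comp_fibre hT₂
  have hθ : theta N U := hN.theta_extension hU (theta_of _ U₁ a₁ b₁ c₁) (theta_of _ U₂ a₂ b₂ c₂)
  have hUW (j : ℤ) : wideClosure (N n) ((homology A j).obj U) := by
    have h₁ (j : ℤ) := wideClosure_mono (hN.mono (by lia : n - 1 ≤ n)) _ (a₁ j)
    exact prop_of_exact_of_isWide _ (hU.exact_homology₂ (j + 1) j (j - 1) rfl (by lia))
      (a₂ _) (h₁ _) (a₂ _) (h₁ _)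
  have hU₀ (j : ℤ) (hj : j < n - 1) : IsZero ((homology A j).obj U) :=
    hU.isZero_homology₂ j (b₁ j hj) (b₂ j (by lia))
  have hV₀ (j : ℤ) (hj : j < n) : IsZero ((homology A j).obj V) :=
    hT.isZero_homology₃ j (j - 1) (by lia) (hX j (by lia)) (hU₀ _ (by lia))
  -- Here `H_j V ≅ H_{j-1} U` lies in the wide closure of `N n`, and its stalk is a summand of `V`;
  -- but `V` is orthogonal to such stalks.
  have hV₁ (j : ℤ) (hj : n + 2 ≤ j) : IsZero ((homology A j).obj V) := by
    obtain ⟨M, s, r, hs, hs'⟩ := exists_stalk_summand hA V j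
    have hj' : j - 1 + 1 = j := by lia
    have : Mono (hT.connecting j (j - 1) hj') :=
      (hT.exact₃ j (j - 1) hj').mono_g ((hX j (by lia)).eq_of_src _ _)
    have : Epi (hT.connecting j (j - 1) hj') :=
      (hT.exact₁ j (j - 1) hj').epi_f ((hX (j - 1) (by lia)).eq_of_tgt _ _)
    have := isIso_of_mono_of_epi (hT.connecting j (j - 1) hj')
    have hM : wideClosure (N n) M := (wideClosure (N n)).prop_of_iso
      ((stalkHomologyIso A j).symm.app M ≪≫ asIso ((homology A j).map s) ≪≫
        asIso (hT.connecting j (j - 1) hj')).symm (hUW _)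
    have h₀ : IsZero ((stalk A j).obj M) := by
      rw [IsZero.iff_id_eq_zero, ← hs, d₂ j (by lia) M hM s, zero_comp]
    exact (Functor.map_isZero (homology A j) h₀).of_iso (asIso ((homology A j).map s)).symm
  refine ⟨U, V, f, _, h, hT, hθ, fun j Z hZ φ => ?_⟩
  by_cases hj : j + 2 ≤ n
  · exact hom_eq_zero_of_add_two_le hA j (fun k hk => isZero_homology_stalk Z hk.ne')
      (fun k hk => hV₀ k (by lia)) φ
  by_cases hj' : n + 2 ≤ j
  · exact hom_eq_zero_of_lt j (fun k hk => isZero_homology_stalk Z hk.ne)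
      (fun k hk => hV₁ k (by lia)) φ
  obtain rfl | rfl | rfl : j = n - 1 ∨ j = n ∨ j = n + 1 := by lia
  · obtain ⟨ψ, rfl⟩ := hT₂.coyoneda₃ φ (hom_eq_zero_of_add_two_le hA (n - 1)
      (fun k hk => isZero_homology_stalk Z (by lia))
      (fun k hk => (isZero_homology_shift_iff U₂ 1 k (k - 1) (by lia)).2 (b₂ _ (by lia))) _)
    rw [e₁ Z hZ ψ, zero_comp]
  · exact e₂ Z hZ φ
  -- The delicate degree. A map from `Z[n+1]` is given by `z : Z → M` with `M ≅ H_{n+1} V`, and `M`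
  -- embeds in `H_n U`. It is shown that `image z` is in the wide closure of `N n`, so that
  -- orthogonality forces `z = 0`.
  · obtain ⟨V', V'', i, p, δ, hV, hV', hV'', hi, -⟩ := exists_truncation V (n + 1)
    obtain ⟨M, ⟨e⟩⟩ := exists_iso_stalk V' (n + 1) fun k hk => by
      rcases lt_or_gt_of_ne hk with hk | hk
      · exact hV' k hk
      · have := hi k hk.le
        exact (hV₁ k (by lia)).of_iso (asIso ((homology A k).map i))
    have hm : Mono i := by
      obtain ⟨r, -, hr, -⟩ := hV.split (truncation_splits hA hV' hV'' δ)
      exact mono_of_mono_fac hr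
    obtain ⟨ψ, rfl⟩ := hV.coyoneda₂ φ (hom_eq_zero_of_lt (n + 1)
      (fun k hk => isZero_homology_stalk Z (by lia)) hV'' _)
    obtain ⟨z, hz⟩ := (stalk A (n + 1)).map_surjective (ψ ≫ e.hom)
    have := hi (n + 1) le_rfl
    have : Mono (hT.connecting (n + 1) n rfl) :=
      (hT.exact₃ (n + 1) n rfl).mono_g ((hX (n + 1) (by lia)).eq_of_src _ _)
    let m : M ⟶ (homology A n).obj U := (stalkHomologyIso A (n + 1)).inv.app M ≫
      (homology A (n + 1)).map e.inv ≫ (homology A (n + 1)).map i ≫ hT.connecting (n + 1) n rfl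
    have : Mono m := inferInstance
    -- Since `Z` is in `N (n + 1)` and `H_n U` in `N n`, the five-term condition covers this
    -- cokernel. The image of `z` is then the kernel of a map from `H_n U` to an object of `N n`.
    have hcok : N n (cokernel (z ≫ m)) := by
      have h₀ (k : ℤ) : N k 0 := hN.prop_of_isZero (isZero_zero A) k
      refine hN.of_exact n (z ≫ m) (cokernel.π (z ≫ m)) (0 : _ ⟶ (0 : A)) (0 : (0 : A) ⟶ 0) (exact_mk₄
        (w₁ := cokernel.condition _) (w₂ := comp_zero) (w₃ := comp_zero)
        (ShortComplex.exact_cokernel _) ?_ (ShortComplex.exact_of_isZero_X₂ _ (isZero_zero A)))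
        hZ (hθ n) (h₀ _) (h₀ _)
      exact (ShortComplex.exact_iff_epi _ rfl).2 inferInstance
    have hI : wideClosure (N n) (image z) := by
      have hS : (ShortComplex.mk (image.ι z ≫ m) (cokernel.π (image.ι z ≫ m))
        (cokernel.condition _)).ShortExact := { exact := ShortComplex.exact_cokernel _ }
      refine (wideClosure (N n)).prop_of_isLimit_kernelFork hS.fIsKernel (hUW n)
        (le_wideClosure _ _ ((N n).prop_of_iso ?_ hcok))
      exact cokernelIsoOfEq (image.fac_assoc z m).symm ≪≫
        cokernelEpiComp (factorThruImage z) (image.ι z ≫ m)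
    have h₁ := d₂ (n + 1) (by lia) _ hI ((stalk A (n + 1)).map (image.ι z) ≫ e.inv ≫ i)
    have h₂ : (stalk A (n + 1)).map (image.ι z) = 0 := by
      rw [← cancel_mono (e.inv ≫ i), h₁, zero_comp]
    rw [← image.fac z, Functor.map_comp, h₂, comp_zero] at hz
    have h₃ : ψ = 0 := by rw [← cancel_mono e.hom, ← hz, zero_comp]
    rw [h₃, zero_comp]

/-- Split dévissage reduces to concentrated objects, and approximations of the two summands are
added. -/
theorem IsNarrowSequence.exists_approximation (hA : ExtTwoVanishes A) (X : Bounded A) :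
    ∃ (U V : Bounded A) (f : U ⟶ X) (g : X ⟶ V) (h : V ⟶ U⟦(1 : ℤ)⟧), IsTri f g h ∧
      theta N U ∧ ∀ Y, theta N Y → ∀ φ : Y ⟶ V, φ = 0 := by
  suffices ∃ (U V : Bounded A) (f : U ⟶ X) (g : X ⟶ V) (h : V ⟶ U⟦(1 : ℤ)⟧), IsTri f g h ∧
      theta N U ∧ ∀ k Z, N k Z → ∀ φ : (stalk A k).obj Z ⟶ V, φ = 0 by
    obtain ⟨U, V, f, g, h, hT, hU, hV⟩ := this
    exact ⟨U, V, f, g, h, hT, hU, fun Y hY => hN.hom_eq_zero_of_theta hV hY⟩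
  refine devissage_split hA (fun X => ∃ (U V : Bounded A) (f : U ⟶ X) (g : X ⟶ V)
    (h : V ⟶ U⟦(1 : ℤ)⟧), IsTri f g h ∧ theta N U ∧
      ∀ k Z, N k Z → ∀ φ : (stalk A k).obj Z ⟶ V, φ = 0) X ?_ ?_ ?_
  · intro Y hY
    obtain ⟨V, g, h, hT⟩ := IsTri.exists_of_mor₁ (𝟙 Y)
    have hV : IsZero V := (Triangle.isZero₃_iff_isIso₁ _ hT).2 (inferInstanceAs (IsIso (𝟙 Y)))
    exact ⟨Y, V, 𝟙 Y, g, h, hT, fun k => hN.prop_of_isZero (Functor.map_isZero _ hY) k,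
      fun _ _ _ _ => hV.eq_of_tgt _ _⟩
  · exact fun n Y hY _ => hN.exists_approximation_of_concentrated hc hW hA n Y hY
  · rintro X₁ X₂ X₃ f g hT ⟨U₁, V₁, f₁, g₁, h₁, hT₁, hU₁, hV₁⟩ ⟨U₃, V₃, f₃, g₃, h₃, hT₃, hU₃, hV₃⟩
    obtain ⟨U, a, b, hU⟩ := IsTri.exists_of_mor₃ (0 : U₃ ⟶ U₁⟦(1 : ℤ)⟧)
    obtain ⟨c, hc₁, hc₂⟩ := hU.complete₂ hT f₁ f₃ (by simp)
    obtain ⟨V, d, h, hV⟩ := IsTri.exists_of_mor₁ c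
    obtain ⟨r, -, hr, -⟩ := hT.split rfl
    obtain ⟨-, t, -, ht, -⟩ := hU.split rfl
    refine ⟨U, V, c, d, h, hV, hN.theta_extension hU hU₁ hU₃, fun k Z hZ φ => ?_⟩
    -- Rather than identifying the cone of `c` with a sum of `V₁` and `V₃`, orthogonality is derived
    -- from two facts on maps out of `Z[k]`: composition with `c[1]` is injective and composition
    -- with `c` is surjective. Each reduces to the two summands.
    have inj {Xi Ui Vi : Bounded A} {fi : Ui ⟶ Xi} {gi : Xi ⟶ Vi} {hi : Vi ⟶ Ui⟦(1 : ℤ)⟧}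
        (hTi : IsTri fi gi hi) (hVi : ∀ φ : (stalk A k).obj Z ⟶ Vi, φ = 0)
        (ψ : (stalk A k).obj Z ⟶ Ui⟦(1 : ℤ)⟧) (hψ : ψ ≫ fi⟦(1 : ℤ)⟧' = 0) : ψ = 0 := by
      obtain ⟨χ, rfl⟩ := hTi.coyoneda₁ ψ hψ
      rw [hVi χ, zero_comp]
    have h₀ : φ ≫ h = 0 := by
      have e₁ : (φ ≫ h) ≫ b⟦(1 : ℤ)⟧' = 0 := inj hT₃ (hV₃ k Z hZ) _ (by
        rw [Category.assoc, ← Functor.map_comp, hc₂, Functor.map_comp, Category.assoc,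
          reassoc_of% hV.zero₃₁, zero_comp, comp_zero])
      obtain ⟨a', hT'⟩ := hU.shift 1
      obtain ⟨ψ, hψ⟩ := hT'.coyoneda₂ _ e₁
      have e₂ : ψ = 0 := inj hT₁ (hV₁ k Z hZ) ψ (by
        have : IsSplitMono (f⟦(1 : ℤ)⟧') := ⟨⟨r⟦(1 : ℤ)⟧', by
          rw [← Functor.map_comp, hr, CategoryTheory.Functor.map_id]⟩⟩
        rw [← cancel_mono (f⟦(1 : ℤ)⟧'), Category.assoc, ← Functor.map_comp, ← hc₁,
          Functor.map_comp, ← Category.assoc, ← hψ, Category.assoc, hV.zero₃₁, comp_zero,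
          zero_comp])
      rw [hψ, e₂, zero_comp]
    obtain ⟨ψ, rfl⟩ := hV.coyoneda₃ φ h₀
    obtain ⟨χ, hχ⟩ := hT₃.coyoneda₂ (ψ ≫ g) (hV₃ k Z hZ _)
    obtain ⟨ω, hω⟩ := hT.coyoneda₂ (ψ - (χ ≫ t) ≫ c) (by
      rw [Preadditive.sub_comp, Category.assoc, Category.assoc, ← hc₂, reassoc_of% ht, hχ, sub_self])
    obtain ⟨ω, rfl⟩ := hT₁.coyoneda₂ ω (hV₁ k Z hZ _)
    have hψ : ψ = (χ ≫ t + ω ≫ a) ≫ c := by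
      rw [Preadditive.add_comp, Category.assoc ω, hc₁, ← Category.assoc ω, ← hω]
      abel
    rw [hψ, Category.assoc, hV.zero₁₂, comp_zero]

end Theta

/-! ### From narrow sequences to t-structures. -/

section TStructure

open DerivedCategory Pretriangulated ZeroObject

variable {A : Type u} [Category.{v} A] [Abelian A] [HasDerivedCategory.{w} A]

/-- The t-structure with a given aisle. -/
def tStructureOfAisle (U : ObjectProperty (Bounded A)) [U.IsClosedUnderIsomorphisms]
    (shift : ∀ X, U X → U (X⟦(1 : ℤ)⟧))
    (approx : ∀ X, ∃ (Y Z : Bounded A) (f : Y ⟶ X) (g : X ⟶ Z) (h : Z ⟶ Y⟦(1 : ℤ)⟧), IsTri f g h ∧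
      U Y ∧ ∀ T, U T → ∀ φ : T ⟶ Z, φ = 0) : TStructure (Bounded A) :=
  have iso : (shiftOrthogonal U).IsClosedUnderIsomorphisms :=
    ⟨fun e h T hT f => by rw [← cancel_mono e.inv, h T hT (f ≫ e.inv), zero_comp]⟩
  { le n := U.inverseImage (shiftFunctor _ n)
    ge n := (shiftOrthogonal U).inverseImage (shiftFunctor _ n)
    le_shift n a n' h X hX := U.prop_of_iso ((shiftFunctorAdd' (Bounded A) a n' n h).app X) hX
    ge_shift n a n' h X hX :=
      (shiftOrthogonal U).prop_of_iso ((shiftFunctorAdd' (Bounded A) a n' n h).app X) hX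
    zero' X Y f hX hY := (shiftFunctor (Bounded A) (1 : ℤ)).map_injective ((hY X
      (U.prop_of_iso ((shiftFunctorZero (Bounded A) ℤ).app X) hX) _).trans
        (Functor.map_zero _ _ _).symm)
    le_zero_le X hX := shift X (U.prop_of_iso ((shiftFunctorZero (Bounded A) ℤ).app X) hX)
    ge_one_le X hX := (shiftOrthogonal U).prop_of_iso ((shiftFunctorZero (Bounded A) ℤ).symm.app X)
      fun Y hY f => (shiftFunctor (Bounded A) (1 : ℤ)).map_injective
        ((hX _ (shift Y hY) _).trans (Functor.map_zero _ _ _).symm)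
    exists_triangle_zero_one X := by
      obtain ⟨Y, Z, f, g, h, hT, hY, hZ⟩ := approx X
      refine ⟨Y, Z, U.prop_of_iso ((shiftFunctorZero (Bounded A) ℤ).symm.app Y) hY, ?_, f, g, h, hT⟩
      intro T hT φ
      obtain ⟨φ, rfl⟩ := (shiftFunctor (Bounded A) (1 : ℤ)).map_surjective φ
      rw [hZ T hT φ, Functor.map_zero] }

theorem tStructureOfAisle_le_zero (U : ObjectProperty (Bounded A)) [U.IsClosedUnderIsomorphisms]
    (shift) (approx) : (tStructureOfAisle U shift approx).le 0 = U := by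
  ext X
  exact U.prop_iff_of_iso ((shiftFunctorZero (Bounded A) ℤ).app X)

theorem tStructureOfAisle_ge_zero (U : ObjectProperty (Bounded A)) [U.IsClosedUnderIsomorphisms]
    (shift) (approx) : (tStructureOfAisle U shift approx).ge 0 = shiftOrthogonal U := by
  have iso : (shiftOrthogonal U).IsClosedUnderIsomorphisms :=
    ⟨fun e h T hT f => by rw [← cancel_mono e.inv, h T hT (f ≫ e.inv), zero_comp]⟩
  ext X
  exact (shiftOrthogonal U).prop_iff_of_iso ((shiftFunctorZero (Bounded A) ℤ).app X)

/-- Stalk complexes in `θ(N)` already determine every `N k`. -/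
theorem theta_injective {N N' : ℤ → ObjectProperty A} (hN : IsNarrowSequence N)
    (hN' : IsNarrowSequence N') (h : theta N = theta N') : N = N' := by
  funext k
  ext M
  rw [← hN.theta_stalk_iff, h, hN'.theta_stalk_iff]

/-- The t-structure with aisle `theta N`. -/
def thetaTStructure (hA : ExtTwoVanishes A) {N : ℤ → ObjectProperty A}
    (hN : IsCoreflectiveNarrowSequence N)
    (hW : ∀ k, HasDerivedRightAdjoint A (wideClosure (N k))) : TStructure (Bounded A) :=
  have := hN.isClosedUnderIsomorphisms_theta
  tStructureOfAisle (theta N) (fun _ => hN.theta_shift)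
    (hN.exists_approximation hN.isCoreflective hW hA)

theorem thetaTStructure_le_zero (hA : ExtTwoVanishes A) {N : ℤ → ObjectProperty A}
    (hN : IsCoreflectiveNarrowSequence N)
    (hW : ∀ k, HasDerivedRightAdjoint A (wideClosure (N k))) :
    (thetaTStructure hA hN hW).le 0 = theta N :=
  have := hN.isClosedUnderIsomorphisms_theta
  tStructureOfAisle_le_zero (theta N) (fun _ => hN.theta_shift)
    (hN.exists_approximation hN.isCoreflective hW hA)

theorem thetaTStructure_ge_zero (hA : ExtTwoVanishes A) {N : ℤ → ObjectProperty A}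
    (hN : IsCoreflectiveNarrowSequence N)
    (hW : ∀ k, HasDerivedRightAdjoint A (wideClosure (N k))) :
    (thetaTStructure hA hN hW).ge 0 = shiftOrthogonal (theta N) :=
  have := hN.isClosedUnderIsomorphisms_theta
  tStructureOfAisle_ge_zero (theta N) (fun _ => hN.theta_shift)
    (hN.exists_approximation hN.isCoreflective hW hA)

end TStructure

end NarrowSequences

end

/-! ### The main theorem. -/

theorem mainTheorem5 (A : Type u) [Category.{v} A]
    [Abelian A] [HasDerivedCategory.{w} A]
    (hA : NarrowSequences.IsHereditary A) :
    (∃ Θ : {N : ℤ → ObjectProperty A //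
          NarrowSequences.IsCoreflectiveNarrowSequence N ∧
          ∀ k : ℤ, NarrowSequences.HasDerivedRightAdjoint A
            (NarrowSequences.wideClosure (N k))} →
        TStructure (DerivedCategory.Bounded A),
      Function.Injective Θ ∧
      ∀ N, (Θ N).le 0 = NarrowSequences.theta N.1 ∧
        (Θ N).ge 0 = NarrowSequences.shiftOrthogonal (NarrowSequences.theta N.1)) ∧
    (∃ M : TStructure (DerivedCategory.Bounded A) →
        {N : ℤ → ObjectProperty A //
          NarrowSequences.IsCoreflectiveNarrowSequence N},
      Function.Injective M ∧
      ∀ t, (M t).1 = NarrowSequences.mu (t.le 0)) := by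
  have hA' := hA.extTwoVanishes
  refine ⟨?_, fun t => ⟨_, NarrowSequences.isCoreflectiveNarrowSequence_mu (t := t) hA'⟩,
    fun t t' h => ?_, fun t => rfl⟩
  · refine ⟨fun N => NarrowSequences.thetaTStructure hA' N.2.1 N.2.2, fun N N' h => ?_, fun N =>
      ⟨NarrowSequences.thetaTStructure_le_zero hA' N.2.1 N.2.2,
        NarrowSequences.thetaTStructure_ge_zero hA' N.2.1 N.2.2⟩⟩
    have h' := congrArg (fun t : TStructure _ => t.le 0) h
    dsimp only at h'
    rw [NarrowSequences.thetaTStructure_le_zero, NarrowSequences.thetaTStructure_le_zero] at h'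
    exact Subtype.ext (NarrowSequences.theta_injective N.2.1.toIsNarrowSequence
      N'.2.1.toIsNarrowSequence h')
  -- `theta` is a left inverse of `mu` on aisles, and a t-structure is determined by its aisle.
  · have h' := congrArg (fun N => NarrowSequences.theta N.1) h
    refine NarrowSequences.tStructure_ext ?_
    rwa [NarrowSequences.theta_mu hA', NarrowSequences.theta_mu hA'] at h'
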